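/- Let $K$ be a field with $\operatorname{char} K\neq 2$, let $f\in K[x]$ be squarefree of degree $5$, and let $F=K(x,y)$, $y^2=f(x)$, be the function field of the corresponding curve $C$ of genus two. Let $\infty$ be its place at infinity, let $\mathbb J_F=\mathrm{Div}^0(F)/\{(z): z\in F^\times\}$ be its Jacobian, and let $\iota:(x,y)\mapsto(x,-y)$ be the hyperelliptic involution. A pair $\langle u,v\rangle$ of polynomials in $K[x]$ is the Mumford representation of a divisor $D$ if $u$ is monic, $\deg v<\deg u\le 2$, $u\mid f-v^2$ and $D=\sum_{\mathfrak P\ne\infty}\min\bigl(v_{\mathfrak P}(u(x)),v_{\mathfrak P}(y-v(x))\bigr)\mathfrak P-(\deg u)\,\infty$. Let $P=(s,t)$, $\mu=(\mu_x,\mu_y)$, $\omega=(\omega_x,\omega_y)$ be affine $K$-rational points (places) of $C$, and let $D_1=P+\mu-2\infty$, $D_2=P+\omega-2\infty$. Then the following hold. (1) Suppose that $\langle x^2+ax+b,\,v_1\rangle$ and $\langle x^2+\alpha x+\beta,\,v_2\rangle$ are the Mumford representations of $D_1$ and $D_2$. Then the matrix $$\begin{pmatrix} a^2-b&-a&1&0\\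 ab&-b&0&1\\ \alpha^2-\beta&-\alpha&1&0\\ \alpha\beta&-\beta&0&1\end{pmatrix}$$ is singular. If moreover $\mu_x\ne\omega_x$, then $a\neq\alpha$ and $$s=\frac{\beta-b}{a-\alpha},\quad t=v_1(s),\quad \mu_x=-a-s,\ \ \mu_y=v_1(\mu_x),\quad \omega_x=-\alpha-s,\ \ \omega_y=v_2(\omega_x).$$ (2) The divisors $D_1$, $D_2$, $2P-2\infty$ and $\mu+\omega-2\infty$ have degree $0$, and in $\mathbb J_F$ $$[D_1]\oplus[D_2]=[2P-2\infty]\oplus[\mu+\omega-2\infty].$$ (3) Suppose that $t\ne0$ and that $s,\mu_x,\omega_x$ are pairwise distinct. Let $m=f'(s)/(2t)$ be the slope of the tangent line to $C$ at $P$, and put $u_1=x^2-2sx+s^2$, $u_2=x^2-(\mu_x+\omega_x)x+\mu_x\omega_x$. Then $2P-2\infty$ and $\mu+\omega-2\infty$ have the Mumford representations $$\langle u_1,\ mx+t-ms\rangle,\qquad \Bigl\langle u_2,\ \tfrac{\mu_y-\omega_y}{\mu_x-\omega_x}x+\tfrac{\mu_x\omega_y-\omega_x\mu_y}{\mu_x-\omega_x}\Bigr\rangle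 .$$ The linear system for $(p,q,r,w)\in K^4$ with augmented matrix $$\left[\begin{array}{cccc|c} 3s^2&2s&1&0&m\\ -2s^3&-s^2&0&1&t-ms\\ \mu_x^2+\omega_x(\mu_x+\omega_x)&\mu_x+\omega_x&1&0&\frac{\mu_y-\omega_y}{\mu_x-\omega_x}\\ -\mu_x^2\omega_x-\mu_x\omega_x^2&-\mu_x\omega_x&0&1&\frac{\mu_x\omega_y-\omega_x\mu_y}{\mu_x-\omega_x}\end{array}\right]$$ has exactly one solution. For this solution let $L=px^3+qx^2+rx+w$. Then $u_1u_2$ divides $L^2-f$. The quotient $(L^2-f)/(u_1u_2)$ has degree $2$ and leading coefficient $p^2$ if $p\ne0$; if $p=0$, it has degree $1$ and its leading coefficient is minus that of $f$. Let $u''$ be the quotient divided by its leading coefficient, and let $v''$ be the remainder of $L$ modulo $u''$. Then there is a divisor $G$ of degree $0$ with Mumford representation $\langle u'',v''\rangle$; the divisor $\iota(G)$ has degree $0$ and Mumford representation $\langle u'',-v''\rangle$, and $$[D_1]\oplus[D_2]=-[G]=[\iota(G)].$$ -/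

import Mathlib

open Polynomial

noncomputable section

namespace FunField

/-! ### Places, divisors and the Jacobian of a field extension `F / K` -/

section General

variable (K F : Type*) [Field K] [Field F] [Algebra K F]

/-- A place of `F / K`, given by its valuation ring `𝒪` with `K ⊊ 𝒪 ⊊ F`.
(The place itself is the maximal ideal of `𝒪`.) -/
@[ext]
structure Place where
  /-- the valuation ring of the place -/
  ring : ValuationSubring F
  base_lt : (algebraMap K F).range < ring.toSubring
  lt_top : ring < ⊤

variable {K F}

namespace Place

/-- The inclusion of the constants in the valuation ring of a place. -/
def baseHom (𝔓 : Place K F) : K →+* 𝔓.ring :=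
  (algebraMap K F).codRestrict 𝔓.ring.toSubring fun c => 𝔓.base_lt.le ⟨c, rfl⟩

instance (𝔓 : Place K F) : Algebra K 𝔓.ring := 𝔓.baseHom.toAlgebra

/-- The degree of a place: the dimension of its residue field over `K`. -/
def degree (𝔓 : Place K F) : ℕ :=
  Module.finrank K (IsLocalRing.ResidueField 𝔓.ring)

/-- `z` vanishes at the place, that is, it lies in the maximal ideal of the valuation ring. -/
def IsZero (𝔓 : Place K F) (z : F) : Prop :=
  ∃ w : 𝔓.ring, w ∈ IsLocalRing.maximalIdeal 𝔓.ring ∧ (w : F) = z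

/-- `v_𝔓(z) = n`: there are a uniformizer `t`, i.e. a generator of the maximal ideal, and a unit
`e` of the valuation ring with `z = tⁿ e`. -/
def HasOrd (𝔓 : Place K F) (z : F) (n : ℤ) : Prop :=
  ∃ t : 𝔓.ring, Ideal.span {t} = IsLocalRing.maximalIdeal 𝔓.ring ∧
    ∃ e : 𝔓.ringˣ, z = (t : F) ^ n * ((e : 𝔓.ring) : F)

theorem hasOrd_one (𝔓 : Place K F) {z : F} {n : ℤ} (h : 𝔓.HasOrd z n) : 𝔓.HasOrd 1 0 := by
  obtain ⟨t, ht, -⟩ := h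
  exact ⟨t, ht, 1, by simp⟩

theorem HasOrd.inv {𝔓 : Place K F} {z : F} {n : ℤ} (h : 𝔓.HasOrd z n) : 𝔓.HasOrd z⁻¹ (-n) := by
  obtain ⟨t, ht, e, rfl⟩ := h
  refine ⟨t, ht, e⁻¹, ?_⟩
  have he : (((e⁻¹ : 𝔓.ringˣ) : 𝔓.ring) : F) * ((e : 𝔓.ring) : F) = 1 := by
    exact congrArg Subtype.val e.inv_mul
  rw [mul_inv, zpow_neg, eq_inv_of_mul_eq_one_left he]

theorem HasOrd.mul {𝔓 : Place K F} {z w : F} {m n : ℤ} (hz : 𝔓.HasOrd z m)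
    (hw : 𝔓.HasOrd w n) : 𝔓.HasOrd (z * w) (m + n) := by
  obtain ⟨t, ht, e, rfl⟩ := hz
  obtain ⟨t', ht', e', rfl⟩ := hw
  obtain ⟨a, ha⟩ := Ideal.span_singleton_eq_span_singleton.1 (ht'.trans ht.symm)
  have ht0 : (t' : F) ≠ 0 := by
    intro h0
    have h1 : IsLocalRing.maximalIdeal 𝔓.ring = ⊥ := by
      rw [← ht', Ideal.span_singleton_eq_bot]
      exact Subtype.ext h0
    apply 𝔓.lt_top.ne
    rw [eq_top_iff]
    intro x _
    rcases 𝔓.ring.mem_or_inv_mem x with hx | hx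
    · exact hx
    · have hf := IsLocalRing.isField_iff_maximalIdeal_eq.2 h1
      by_cases hx0 : x = 0
      · rw [hx0]; exact 𝔓.ring.zero_mem
      · obtain ⟨b, hb⟩ := hf.mul_inv_cancel
          (a := (⟨x⁻¹, hx⟩ : 𝔓.ring)) (fun h => inv_ne_zero hx0 (congrArg Subtype.val h))
        have hb' : x⁻¹ * (b : F) = 1 := congrArg Subtype.val hb
        have : x = b := by field_simp at hb'; exact hb'.symm
        rw [this]; exact b.2
  have ha' : (t : F) = t' * ((a : 𝔓.ring) : F) := by rw [← ha]; rfl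
  refine ⟨t', ht', a ^ m * e * e', ?_⟩
  have hpow : (((a ^ m : 𝔓.ringˣ) : 𝔓.ring) : F) = ((a : 𝔓.ring) : F) ^ m := by
    have h := congrArg Units.val (map_zpow (Units.map (𝔓.ring.subtype : 𝔓.ring →* F)) a m)
    rw [Units.val_zpow_eq_zpow_val] at h
    exact h
  rw [ha', mul_zpow, zpow_add₀ ht0]
  push_cast
  rw [hpow]
  ring

/-- The place `{z | σ z ∈ 𝒪}` obtained from the place with valuation ring `𝒪` by an automorphism
`σ` of `F / K`. -/
def comap (σ : F ≃ₐ[K] F) (𝔓 : Place K F) : Place K F where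
  ring := 𝔓.ring.comap (σ : F →+* F)
  base_lt := by
    obtain ⟨h, h'⟩ := SetLike.lt_iff_le_and_exists.1 𝔓.base_lt
    refine SetLike.lt_iff_le_and_exists.2 ⟨?_, ?_⟩
    · rintro _ ⟨c, rfl⟩
      change σ (algebraMap K F c) ∈ 𝔓.ring
      rw [AlgEquiv.commutes]
      exact h ⟨c, rfl⟩
    · obtain ⟨z, hz, hz'⟩ := h'
      refine ⟨σ.symm z, ?_, ?_⟩
      · change σ (σ.symm z) ∈ 𝔓.ring
        rw [AlgEquiv.apply_symm_apply]
        exact hz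
      · rintro ⟨c, hc⟩
        exact hz' ⟨c, by rw [← σ.apply_symm_apply z, ← hc, AlgEquiv.commutes]⟩
  lt_top := by
    obtain ⟨-, z, -, hz⟩ := SetLike.lt_iff_le_and_exists.1 𝔓.lt_top
    refine SetLike.lt_iff_le_and_exists.2 ⟨le_top, σ.symm z, trivial, fun h => hz ?_⟩
    have h' : σ (σ.symm z) ∈ 𝔓.ring := h
    rwa [AlgEquiv.apply_symm_apply] at h'

end Place

variable (K F)

/-- Divisors: finite formal sums of places. -/
abbrev Divisor := Place K F →₀ ℤ

variable {K F}

/-- The degree of a divisor. -/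
def Divisor.degree : Divisor K F →+ ℤ :=
  Finsupp.liftAddHom fun 𝔓 => AddMonoidHom.mulRight (𝔓.degree : ℤ)

variable (K F)

/-- The group of divisors of degree zero. -/
def Divisor.degreeZero : AddSubgroup (Divisor K F) := (Divisor.degree (K := K) (F := F)).ker

/-- The group of principal divisors `(z) = ∑ v_𝔓(z) 𝔓`, `z ≠ 0`.
(The zero divisor is `(1)`, so that it is a member for a trivial reason.) -/
def Divisor.principal : AddSubgroup (Divisor K F) where
  carrier := {D | D = 0 ∨ ∃ z : F, z ≠ 0 ∧ ∀ 𝔓 : Place K F, 𝔓.HasOrd z (D 𝔓)}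
  zero_mem' := Or.inl rfl
  add_mem' := by
    rintro D E (rfl | ⟨z, hz, hD⟩) (rfl | ⟨w, hw, hE⟩)
    · left; simp
    · right; exact ⟨w, hw, by simpa using hE⟩
    · right; exact ⟨z, hz, by simpa using hD⟩
    · right; exact ⟨z * w, mul_ne_zero hz hw, fun 𝔓 => (hD 𝔓).mul (hE 𝔓)⟩
  neg_mem' := by
    rintro D (rfl | ⟨z, hz, hD⟩)
    · left; simp
    · right; exact ⟨z⁻¹, inv_ne_zero hz, fun 𝔓 => (hD 𝔓).inv⟩

/-- The Jacobian: divisors of degree zero modulo principal divisors. -/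
abbrev Jacobian :=
  Divisor.degreeZero K F ⧸ (Divisor.principal K F).addSubgroupOf (Divisor.degreeZero K F)

variable {K F}

/-- The class `[D]` of a divisor of degree zero in the Jacobian. -/
def Divisor.cls (D : Divisor K F) (hD : D ∈ Divisor.degreeZero K F) : Jacobian K F :=
  QuotientAddGroup.mk ⟨D, hD⟩

end General

end FunField

open FunField

/-- A curve `y² = f(x)` of genus two: `char K ≠ 2`, `f` squarefree of degree five. -/
structure GenusTwoCurve (K : Type*) [Field K] where
  /-- the right-hand side of the equation -/
  f : K[X]
  natDegree_f : f.natDegree = 5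
  squarefree_f : Squarefree f
  two_ne_zero : (2 : K) ≠ 0

namespace GenusTwoCurve

variable {K : Type*} [Field K] (H : GenusTwoCurve K)

/-- The polynomial `Y² - f(X)` in `K[X][Y]`. -/
def polynomial : K[X][X] := X ^ 2 - C H.f

theorem monic_polynomial : H.polynomial.Monic := monic_X_pow_sub_C _ (by norm_num)

theorem irreducible_polynomial : Irreducible H.polynomial := by
  have hd : H.polynomial.natDegree = 2 := natDegree_X_pow_sub_C
  rw [H.monic_polynomial.irreducible_iff_roots_eq_zero_of_degree_le_three (by omega) (by omega),
    Multiset.eq_zero_iff_forall_notMem]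
  intro g hg
  have h0 := (mem_roots'.1 hg).2
  simp only [polynomial, IsRoot.def, eval_sub, eval_pow, eval_X, eval_C] at h0
  have h1 := congrArg natDegree (sub_eq_zero.1 h0)
  rw [natDegree_pow, H.natDegree_f] at h1
  omega

/-- The affine coordinate ring `K[x, y]` of the curve. -/
abbrev CoordinateRing : Type _ := AdjoinRoot H.polynomial

instance : IsDomain H.CoordinateRing :=
  AdjoinRoot.isDomain_of_prime H.irreducible_polynomial.prime

/-- The function field `K(x, y)` of the curve. -/
abbrev FunctionField : Type _ := FractionRing H.CoordinateRing

/-- A polynomial in `x`, as an element of the function field. -/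
def ofPoly (g : K[X]) : H.FunctionField :=
  algebraMap H.CoordinateRing H.FunctionField (AdjoinRoot.of H.polynomial g)

/-- The function `x`. -/
def x : H.FunctionField := H.ofPoly X

/-- The function `y`. -/
def y : H.FunctionField :=
  algebraMap H.CoordinateRing H.FunctionField (AdjoinRoot.root H.polynomial)

theorem eval₂_neg_root : H.polynomial.eval₂
    (AdjoinRoot.of H.polynomial) (-AdjoinRoot.root H.polynomial) = 0 := by
  have h := AdjoinRoot.eval₂_root H.polynomial
  have he (z : H.CoordinateRing) : H.polynomial.eval₂ (AdjoinRoot.of H.polynomial) z =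
      z ^ 2 - AdjoinRoot.of H.polynomial H.f := by
    change eval₂ _ z (X ^ 2 - C H.f) = _
    rw [eval₂_sub, eval₂_pow, eval₂_X, eval₂_C]
  rw [he] at h ⊢
  rw [neg_sq, h]

/-- The endomorphism `(x, y) ↦ (x, -y)` of the coordinate ring. -/
def negHom : H.CoordinateRing →ₐ[K] H.CoordinateRing where
  __ := AdjoinRoot.lift (AdjoinRoot.of H.polynomial) (-AdjoinRoot.root H.polynomial)
    H.eval₂_neg_root
  commutes' c := by
    have hc : algebraMap K H.CoordinateRing c = AdjoinRoot.of H.polynomial (C c) := rfl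
    rw [hc]
    exact AdjoinRoot.lift_of H.eval₂_neg_root

theorem negHom_negHom (g : H.CoordinateRing) : H.negHom (H.negHom g) = g := by
  have hof (g : K[X]) : H.negHom (AdjoinRoot.of H.polynomial g) = AdjoinRoot.of H.polynomial g :=
    AdjoinRoot.lift_of H.eval₂_neg_root
  have hroot : H.negHom (AdjoinRoot.root H.polynomial) = -AdjoinRoot.root H.polynomial :=
    AdjoinRoot.lift_root H.eval₂_neg_root
  have : (H.negHom.toRingHom.comp H.negHom.toRingHom) = RingHom.id H.CoordinateRing := by
    refine AdjoinRoot.ringHom_ext ?_ ?_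
    · refine RingHom.ext fun g => ?_
      change H.negHom (H.negHom (AdjoinRoot.of H.polynomial g)) = _
      rw [hof, hof]; rfl
    · change H.negHom (H.negHom (AdjoinRoot.root H.polynomial)) = _
      rw [hroot, map_neg, hroot, neg_neg]; rfl
  exact congrArg (fun φ : H.CoordinateRing →+* H.CoordinateRing => φ g) this

/-- The automorphism `(x, y) ↦ (x, -y)` of the coordinate ring. -/
def negEquiv : H.CoordinateRing ≃ₐ[K] H.CoordinateRing :=
  AlgEquiv.ofAlgHom H.negHom H.negHom (AlgHom.ext H.negHom_negHom) (AlgHom.ext H.negHom_negHom)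

/-- The hyperelliptic involution `(x, y) ↦ (x, -y)` on the function field. -/
def involution : H.FunctionField ≃ₐ[K] H.FunctionField :=
  IsFractionRing.fieldEquivOfAlgEquiv K H.FunctionField H.FunctionField H.negEquiv

/-- The hyperelliptic involution on divisors. -/
def involutionDivisor (D : Divisor K H.FunctionField) : Divisor K H.FunctionField :=
  Finsupp.mapDomain (Place.comap H.involution) D

/-- The place `𝔓` is the affine point `(a, b)`: both `x - a` and `y - b` vanish at `𝔓`. -/
def IsPoint (𝔓 : Place K H.FunctionField) (a b : K) : Prop :=
  𝔓.IsZero (H.x - algebraMap K _ a) ∧ 𝔓.IsZero (H.y - algebraMap K _ b)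

/-- The place `𝔓` is the point at infinity: `x` has a pole at `𝔓`. -/
def IsInfinity (𝔓 : Place K H.FunctionField) : Prop := H.x ∉ 𝔓.ring

/-- `⟨u, v⟩` is the Mumford representation of the divisor `D`: `u` is monic of degree at most two,
`deg v < deg u`, `u ∣ f - v²`, and `D = ∑ min (v_𝔓(u(x)), v_𝔓(y - v(x))) 𝔓 - (deg u) ∞`, where the
sum is over the places `𝔓` different from `∞`. -/
structure IsMumford (u v : K[X]) (D : Divisor K H.FunctionField) : Prop where
  monic : u.Monic
  natDegree_le : u.natDegree ≤ 2
  degree_lt : v.degree < u.degree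
  dvd : u ∣ H.f - v ^ 2
  finite : ∀ 𝔓 : Place K H.FunctionField, ¬ H.IsInfinity 𝔓 →
    ∃ m n : ℤ, 𝔓.HasOrd (H.ofPoly u) m ∧ 𝔓.HasOrd (H.y - H.ofPoly v) n ∧ D 𝔓 = min m n
  infinite : ∀ 𝔓 : Place K H.FunctionField, H.IsInfinity 𝔓 → D 𝔓 = -(u.natDegree : ℤ)

/-- The slope `dy/dx = f'(s) / (2 t)` of the tangent line to the curve at the point `(s, t)`. -/
def tangentSlope (s t : K) : K := H.f.derivative.eval s / (2 * t)

end GenusTwoCurve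

/-- The matrix of the linear system, in the unknown coefficients `(P, Q, R, S)` of
`L = P x³ + Q x² + R x + S`, expressing that `L` has prescribed remainders modulo `x² + a x + b`
and modulo `x² + α x + β`. -/
def interpolationMatrix {K : Type*} [Field K] (a b α β : K) : Matrix (Fin 4) (Fin 4) K :=
  !![a ^ 2 - b, -a, 1, 0;
     a * b, -b, 0, 1;
     α ^ 2 - β, -α, 1, 0;
     α * β, -β, 0, 1]

/-- The matrix of the system for the double point with abscissa `s` and the points with abscissas
`μx`, `ωx`. -/
def sharedMatrix {K : Type*} [Field K] (s μx ωx : K) : Matrix (Fin 4) (Fin 4) K :=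
  !![3 * s ^ 2, 2 * s, 1, 0;
     -2 * s ^ 3, -s ^ 2, 0, 1;
     μx ^ 2 + ωx * (μx + ωx), μx + ωx, 1, 0;
     -μx ^ 2 * ωx - μx * ωx ^ 2, -μx * ωx, 0, 1]

/-- The right-hand side of the system: the coefficients of the tangent line with slope `m` at
`(s, t)` and of the chord through `(μx, μy)` and `(ωx, ωy)`. -/
def sharedVector {K : Type*} [Field K] (m s t μx μy ωx ωy : K) : Fin 4 → K :=
  ![m, t - m * s, (μy - ωy) / (μx - ωx), (μx * ωy - ωx * μy) / (μx - ωx)]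

end

open FunField

open Polynomial

/-! The sum is read off from the divisor of the single function `y - L`. For `u ∣ f - v²`, with no
bound on `deg u`, let `⟨u, v⟩` stand for the divisor with multiplicity `min (ord u) (ord (y - v))`
at the finite places and `-deg u` at infinity (`IsPairDivisor`). Four rules govern these divisors.
For fixed `v` they are additive in `u`, as long as the product divides `f - v²`. They depend only on
`v` modulo `u`. For `u = f - v²` the divisor is that of `y - v`, hence principal. Finally, `⟨u, v⟩ +
⟨u, -v⟩` is the divisor of `u`.

Write `E₁ = 2P - 2∞` and `E₂ = μ + ω - 2∞`. Then `D₁ + D₂ = E₁ + E₂` already as divisors. The cubic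
`L` agrees with the tangent modulo `u₁` and with the chord modulo `u₂`, so `E₁ = ⟨u₁, L⟩`, `E₂ =
⟨u₂, L⟩`, and `f - L²` is a constant times `u₁ u₂ u''`. By the rules, the divisor of `y - L` is `E₁
+ E₂ + G` with `G = ⟨u'', L⟩ = ⟨u'', v''⟩`. Hence the sum of the classes is `-[G]`, and the last
rule turns this into `[ι G]`. The cubic exists and is unique because `u₁` and `u₂` are coprime: the
determinant of the system is their resultant.

At finite places the rules rest on `ord_y_sub_trichotomy`: one of `y - v`, `y + v` is a unit, or
both have order one at a ramified place, where polynomials in `x` have even order. This requires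
discrete valuations (`localForm`). At infinity polynomials have even order and `y` has order `-5`,
so nothing cancels. Degree zero follows by factoring `u` into primes: a prime `π ∣ f - v²`
determines with `v` exactly one place, with residue field `K[x]/(π)` (`exists_place`,
`place_unique`, `degree_place`). -/

namespace FunField

/-! ### Places as discrete valuations. -/

section General

variable {K F : Type*} [Field K] [Field F] [Algebra K F]

namespace Place

/-- The canonical valuation of a place. -/
noncomputable abbrev val (𝔓 : Place K F) : Valuation F 𝔓.ring.ValueGroup := 𝔓.ring.valuation

theorem val_le_one_iff (𝔓 : Place K F) {z : F} : 𝔓.val z ≤ 1 ↔ z ∈ 𝔓.ring :=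
  𝔓.ring.valuation_le_one_iff z

theorem isZero_iff (𝔓 : Place K F) {z : F} : 𝔓.IsZero z ↔ 𝔓.val z < 1 := by
  constructor
  · rintro ⟨w, hw, rfl⟩
    exact (𝔓.ring.valuation_lt_one_iff w).1 hw
  · intro h
    exact ⟨⟨z, 𝔓.val_le_one_iff.1 h.le⟩, (𝔓.ring.valuation_lt_one_iff _).2 h, rfl⟩

theorem val_mul_lt_one (𝔓 : Place K F) {z w : F} (hz : 𝔓.val z ≤ 1) (hw : 𝔓.val w < 1) :
    𝔓.val (z * w) < 1 := by
  rw [map_mul]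
  exact mul_lt_one_of_nonneg_of_lt_one_right hz zero_le hw

theorem val_algebraMap (𝔓 : Place K F) {c : K} (hc : c ≠ 0) : 𝔓.val (algebraMap K F c) = 1 := by
  have h (d : K) : 𝔓.val (algebraMap K F d) ≤ 1 := 𝔓.val_le_one_iff.2 (𝔓.base_lt.le ⟨d, rfl⟩)
  refine le_antisymm (h c) ?_
  have h1 := h c⁻¹
  rw [map_inv₀, map_inv₀] at h1
  exact (inv_le_one₀ (by simpa [zero_lt_iff] using hc)).1 h1

theorem ext_val {𝔓 𝔔 : Place K F} (h : ∀ z, 𝔓.val z ≤ 1 ↔ 𝔔.val z ≤ 1) : 𝔓 = 𝔔 :=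
  Place.ext <| ValuationSubring.ext _ _ fun z => by
    rw [← val_le_one_iff, ← val_le_one_iff, h]

/-- The value group of the place is generated by the value of `t`, which is less than one. -/
structure IsUniformizer (𝔓 : Place K F) (t : F) : Prop where
  ne_zero : t ≠ 0
  val_lt_one : 𝔓.val t < 1
  exists_eq_zpow : ∀ z : F, z ≠ 0 → ∃ n : ℤ, 𝔓.val z = 𝔓.val t ^ n

namespace IsUniformizer

variable {𝔓 : Place K F} {t : F} (ht : 𝔓.IsUniformizer t)
include ht

theorem val_pos : 0 < 𝔓.val t := by simpa [zero_lt_iff] using ht.ne_zero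

theorem strictAnti : StrictAnti fun n : ℤ => 𝔓.val t ^ n :=
  zpow_right_strictAnti₀ ht.val_pos ht.val_lt_one

theorem span_eq : Ideal.span {(⟨t, 𝔓.val_le_one_iff.1 ht.val_lt_one.le⟩ : 𝔓.ring)} =
    IsLocalRing.maximalIdeal 𝔓.ring := by
  apply le_antisymm
  · rw [Ideal.span_singleton_le_iff_mem, ValuationSubring.valuation_lt_one_iff]
    exact ht.val_lt_one
  · intro z hz
    rw [Ideal.mem_span_singleton]
    rw [ValuationSubring.valuation_lt_one_iff] at hz
    by_cases h0 : z = 0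
    · rw [h0]; exact dvd_zero _
    obtain ⟨n, hn⟩ := ht.exists_eq_zpow z (fun h => h0 (Subtype.ext h))
    have h1 : 1 ≤ n := by
      by_contra! hlt
      have : 𝔓.val t ^ (0 : ℤ) ≤ 𝔓.val t ^ n := ht.strictAnti.antitone (by omega)
      rw [zpow_zero, ← hn] at this
      exact hz.not_ge this
    have h2 : 𝔓.val (z : F) ≤ 𝔓.val t := by
      rw [hn]
      simpa using ht.strictAnti.antitone h1
    obtain ⟨a, ha⟩ := (𝔓.ring.valuation_le_iff _ _).1 h2
    exact ⟨a, Subtype.ext (by rw [← ha, mul_comm]; rfl)⟩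

/-- `HasOrd` allows any generator of the maximal ideal, but two generators differ by a unit and so
have the same value. -/
theorem hasOrd_iff {z : F} {n : ℤ} : 𝔓.HasOrd z n ↔ 𝔓.val z = 𝔓.val t ^ n := by
  constructor
  · rintro ⟨w, hw, e, rfl⟩
    obtain ⟨a, ha⟩ := Ideal.span_singleton_eq_span_singleton.1 (hw.trans ht.span_eq.symm)
    have h1 : 𝔓.val t = 𝔓.val (w : F) := by
      have : t = w * ((a : 𝔓.ring) : F) := (congrArg Subtype.val ha).symm
      rw [this, map_mul, ValuationSubring.valuation_unit, mul_one]
    rw [map_mul, ValuationSubring.valuation_unit, mul_one, map_zpow₀, h1]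
  · intro h
    rw [← map_zpow₀] at h
    obtain ⟨a, ha⟩ := (𝔓.ring.valuation_eq_iff _ _).1 h
    exact ⟨_, ht.span_eq, a, by rw [← ha, mul_comm]⟩

theorem exists_hasOrd {z : F} (hz : z ≠ 0) : ∃ n, 𝔓.HasOrd z n := by
  obtain ⟨n, hn⟩ := ht.exists_eq_zpow z hz
  exact ⟨n, ht.hasOrd_iff.2 hn⟩

end IsUniformizer

theorem HasOrd.ne_zero {𝔓 : Place K F} {t z : F} (ht : 𝔓.IsUniformizer t) {n : ℤ}
    (h : 𝔓.HasOrd z n) : z ≠ 0 := by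
  rintro rfl
  have h1 := ht.hasOrd_iff.1 h
  rw [map_zero] at h1
  exact (zpow_pos ht.val_pos n).ne h1

/-- The order of `z` at the place (zero if it is not defined). -/
noncomputable def ord (𝔓 : Place K F) (z : F) : ℤ :=
  open Classical in if h : ∃ n, 𝔓.HasOrd z n then h.choose else 0

namespace IsUniformizer

variable {𝔓 : Place K F} {t : F} (ht : 𝔓.IsUniformizer t)
include ht

theorem val_eq {z : F} (hz : z ≠ 0) : 𝔓.val z = 𝔓.val t ^ 𝔓.ord z := by
  have h := ht.exists_hasOrd hz
  have : 𝔓.ord z = h.choose := dif_pos h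
  rw [this]
  exact ht.hasOrd_iff.1 h.choose_spec

theorem hasOrd_iff_ord {z : F} (hz : z ≠ 0) {n : ℤ} : 𝔓.HasOrd z n ↔ 𝔓.ord z = n := by
  rw [ht.hasOrd_iff, ht.val_eq hz]
  exact ht.strictAnti.injective.eq_iff

theorem ord_eq_of_val_eq {z : F} {n : ℤ} (h : 𝔓.val z = 𝔓.val t ^ n) : 𝔓.ord z = n := by
  have h1 := ht.hasOrd_iff.2 h
  exact (ht.hasOrd_iff_ord (h1.ne_zero ht)).1 h1

theorem ord_self : 𝔓.ord t = 1 := ht.ord_eq_of_val_eq (by simp)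

theorem ord_mul {z w : F} (hz : z ≠ 0) (hw : w ≠ 0) : 𝔓.ord (z * w) = 𝔓.ord z + 𝔓.ord w :=
  ht.ord_eq_of_val_eq <| by
    rw [map_mul, ht.val_eq hz, ht.val_eq hw, zpow_add₀ ht.val_pos.ne']

theorem ord_nonneg_iff {z : F} (hz : z ≠ 0) : 0 ≤ 𝔓.ord z ↔ 𝔓.val z ≤ 1 := by
  rw [ht.val_eq hz, ← zpow_zero (𝔓.val t)]
  exact ht.strictAnti.le_iff_ge.symm

theorem ord_pos_iff {z : F} (hz : z ≠ 0) : 0 < 𝔓.ord z ↔ 𝔓.val z < 1 := by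
  rw [ht.val_eq hz, ← zpow_zero (𝔓.val t)]
  exact ht.strictAnti.lt_iff_gt.symm

theorem ord_add {z w : F} (hz : z ≠ 0) (hw : w ≠ 0) (h : 𝔓.ord z < 𝔓.ord w) :
    𝔓.ord (z + w) = 𝔓.ord z :=
  ht.ord_eq_of_val_eq <| by
    rw [← ht.val_eq hz]
    refine Valuation.map_add_eq_of_lt_left _ ?_
    rw [ht.val_eq hz, ht.val_eq hw]
    exact ht.strictAnti h

end IsUniformizer

/-- A place with residue field `K[x]/(π)` has degree `deg π`. -/
theorem degree_eq (𝔓 : Place K F) {w : F} (hw : w ∈ 𝔓.ring) {π : K[X]} (hπ : Irreducible π)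
    (hker : ∀ g : K[X], 𝔓.val (aeval w g) < 1 ↔ π ∣ g)
    (hsurj : ∀ z : F, 𝔓.val z ≤ 1 → ∃ g : K[X], 𝔓.val (z - aeval w g) < 1) :
    𝔓.degree = π.natDegree := by
  let ψ : K[X] →ₐ[K] 𝔓.ring := aeval (⟨w, hw⟩ : 𝔓.ring)
  let ρ : 𝔓.ring →ₐ[K] IsLocalRing.ResidueField 𝔓.ring :=
    IsScalarTower.toAlgHom K 𝔓.ring (IsLocalRing.ResidueField 𝔓.ring)
  let ι : 𝔓.ring →ₐ[K] F := { 𝔓.ring.subtype with commutes' := fun c => rfl }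
  have hψ (g : K[X]) : ((ψ g : 𝔓.ring) : F) = aeval w g := by
    have := Polynomial.aeval_algHom_apply ι (⟨w, hw⟩ : 𝔓.ring) g
    exact this.symm
  -- Evaluation at the residue class of `w`. The hypotheses say that it is onto with kernel `(π)`,
  -- so the residue field is `K[x]/(π)`.
  let φ := ρ.comp ψ
  have hφker : RingHom.ker φ = Ideal.span {π} := by
    ext g
    rw [RingHom.mem_ker, Ideal.mem_span_singleton, ← hker, ← hψ]
    have : φ g = IsLocalRing.residue 𝔓.ring (ψ g) := rfl
    rw [this, IsLocalRing.residue_eq_zero_iff, ValuationSubring.valuation_lt_one_iff]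
  have hφsurj : Function.Surjective φ := by
    intro r
    obtain ⟨z, rfl⟩ := IsLocalRing.residue_surjective r
    obtain ⟨g, hg⟩ := hsurj z (𝔓.val_le_one_iff.2 z.2)
    refine ⟨g, ?_⟩
    have : φ g = IsLocalRing.residue 𝔓.ring (ψ g) := rfl
    rw [this, eq_comm, ← sub_eq_zero, ← map_sub, IsLocalRing.residue_eq_zero_iff,
      ValuationSubring.valuation_lt_one_iff]
    push_cast
    rw [hψ]
    exact hg
  have e := (Ideal.quotientKerAlgEquivOfSurjective hφsurj).toLinearEquiv.finrank_eq
  have e' := (Ideal.quotientEquivAlgOfEq K hφker).toLinearEquiv.finrank_eq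
  rw [degree, ← e, e']
  have := (AdjoinRoot.powerBasis hπ.ne_zero).finrank
  rw [AdjoinRoot.powerBasis_dim] at this
  exact this

end Place

end General

end FunField

/-! ### Normal forms `(a + b y) / c` in the function field. -/

namespace GenusTwoCurve

variable {K : Type*} [Field K] (H : GenusTwoCurve K)

/-- The inclusion of `K[x]` in the function field. -/
noncomputable def ofPolyHom : K[X] →ₐ[K] H.FunctionField where
  toRingHom := (algebraMap H.CoordinateRing H.FunctionField).comp (AdjoinRoot.of H.polynomial)
  commutes' _ := rfl

theorem ofPolyHom_C (c : K) : H.ofPolyHom (C c) = algebraMap K H.FunctionField c := rfl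

theorem ofPolyHom_X : H.ofPolyHom X = H.x := rfl

theorem aeval_x (g : K[X]) : aeval H.x g = H.ofPolyHom g := by
  have : aeval H.x = H.ofPolyHom := by
    ext
    rw [aeval_X, ofPolyHom_X]
  rw [this]

theorem ofPolyHom_injective : Function.Injective H.ofPolyHom := by
  have h1 : Function.Injective (AdjoinRoot.of H.polynomial) := by
    apply AdjoinRoot.of.injective_of_degree_ne_zero
    have : H.polynomial.natDegree = 2 := natDegree_X_pow_sub_C
    exact (natDegree_pos_iff_degree_pos.1 (by omega)).ne'
  exact (IsFractionRing.injective H.CoordinateRing H.FunctionField).comp h1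

theorem ofPolyHom_ne_zero {g : K[X]} (hg : g ≠ 0) : H.ofPolyHom g ≠ 0 :=
  (map_ne_zero_iff _ H.ofPolyHom_injective).2 hg

theorem y_sq : H.y ^ 2 = H.ofPolyHom H.f := by
  have h := AdjoinRoot.eval₂_root H.polynomial
  have h2 : (AdjoinRoot.root H.polynomial) ^ 2 = AdjoinRoot.of H.polynomial H.f := by
    rw [polynomial, eval₂_sub, eval₂_pow, eval₂_X, eval₂_C] at h
    exact sub_eq_zero.1 h
  have h3 := congrArg (algebraMap H.CoordinateRing H.FunctionField) h2
  rw [map_pow] at h3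
  exact h3

theorem f_ne_zero : H.f ≠ 0 := by
  intro h
  have := H.natDegree_f
  rw [h, natDegree_zero] at this
  omega

theorem y_ne_zero : H.y ≠ 0 := by
  intro h
  have := H.y_sq
  rw [h, zero_pow (by norm_num)] at this
  exact H.ofPolyHom_ne_zero H.f_ne_zero this.symm

/-- For nonzero `a`, `b`, the degree of `a²` is even, while that of `b² f` is odd. -/
theorem norm_ne_zero {a b : K[X]} (h : a ≠ 0 ∨ b ≠ 0) : a ^ 2 - b ^ 2 * H.f ≠ 0 := by
  intro h0
  have h1 : a ^ 2 = b ^ 2 * H.f := sub_eq_zero.1 h0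
  by_cases hb : b = 0
  · rw [hb] at h1
    simp at h1
    simp [h1, hb] at h
  · have := congrArg natDegree h1
    rw [natDegree_pow, natDegree_mul (pow_ne_zero _ hb) H.f_ne_zero, natDegree_pow,
      H.natDegree_f] at this
    omega

theorem add_mul_sub (a b : K[X]) :
    (H.ofPolyHom a + H.ofPolyHom b * H.y) * (H.ofPolyHom a - H.ofPolyHom b * H.y) =
      H.ofPolyHom (a ^ 2 - b ^ 2 * H.f) := by
  rw [map_sub, map_mul, map_pow, map_pow, ← y_sq]
  ring

theorem add_mul_y_ne_zero {a b : K[X]} (h : a ≠ 0 ∨ b ≠ 0) :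
    H.ofPolyHom a + H.ofPolyHom b * H.y ≠ 0 := by
  intro h0
  have := H.add_mul_sub a b
  rw [h0, zero_mul] at this
  exact H.ofPolyHom_ne_zero (H.norm_ne_zero h) this.symm

theorem y_sub_ne_zero (v : K[X]) : H.y - H.ofPolyHom v ≠ 0 := by
  have := H.add_mul_y_ne_zero (a := -v) (b := 1) (Or.inr one_ne_zero)
  rwa [map_neg, map_one, one_mul, neg_add_eq_sub] at this

theorem exists_coordinateRing_repr (z : H.CoordinateRing) :
    ∃ a b : K[X], algebraMap H.CoordinateRing H.FunctionField z =
      H.ofPolyHom a + H.ofPolyHom b * H.y := by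
  obtain ⟨g, rfl⟩ := AdjoinRoot.mk_surjective z
  induction g using Polynomial.induction_on' with
  | add p q hp hq =>
    obtain ⟨a, b, h⟩ := hp
    obtain ⟨c, d, h'⟩ := hq
    refine ⟨a + c, b + d, ?_⟩
    rw [map_add, map_add, h, h', map_add, map_add]
    ring
  | monomial n c =>
    have : algebraMap H.CoordinateRing H.FunctionField
        (AdjoinRoot.mk H.polynomial (monomial n c)) = H.ofPolyHom c * H.y ^ n := by
      rw [← C_mul_X_pow_eq_monomial, map_mul, map_mul, map_pow, map_pow]
      rfl
    rw [this]
    obtain ⟨k, rfl | rfl⟩ := n.even_or_odd'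
    · refine ⟨c * H.f ^ k, 0, ?_⟩
      rw [pow_mul, y_sq, map_mul, map_pow, map_zero, zero_mul, add_zero]
    · refine ⟨0, c * H.f ^ k, ?_⟩
      rw [pow_succ, pow_mul, y_sq, map_mul, map_pow, map_zero, zero_add, mul_assoc]

theorem exists_repr (z : H.FunctionField) : ∃ a b c : K[X], c ≠ 0 ∧
    z = (H.ofPolyHom a + H.ofPolyHom b * H.y) / H.ofPolyHom c := by
  obtain ⟨α, β, hβ, rfl⟩ := IsFractionRing.div_surjective (A := H.CoordinateRing) z
  obtain ⟨a, b, h⟩ := H.exists_coordinateRing_repr α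
  obtain ⟨c, d, h'⟩ := H.exists_coordinateRing_repr β
  have hβ0 : algebraMap H.CoordinateRing H.FunctionField β ≠ 0 :=
    IsFractionRing.to_map_ne_zero_of_mem_nonZeroDivisors hβ
  have hcd : c ≠ 0 ∨ d ≠ 0 := by
    by_contra! h0
    rw [h', h0.1, h0.2] at hβ0
    simp at hβ0
  have hn := H.norm_ne_zero hcd
  -- Numerator and denominator are multiplied by the conjugate `c - d y`, which turns the
  -- denominator into its norm.
  refine ⟨a * c - b * d * H.f, b * c - a * d, _, hn, ?_⟩
  have hn' := H.ofPolyHom_ne_zero hn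
  rw [h, h']
  rw [h'] at hβ0
  rw [div_eq_div_iff hβ0 hn', ← add_mul_sub]
  simp only [map_sub, map_mul, ← y_sq]
  ring

theorem exists_repr_ne_zero {z : H.FunctionField} (hz : z ≠ 0) : ∃ a b c : K[X], c ≠ 0 ∧
    (a ≠ 0 ∨ b ≠ 0) ∧ z = (H.ofPolyHom a + H.ofPolyHom b * H.y) / H.ofPolyHom c := by
  obtain ⟨a, b, c, hc, rfl⟩ := H.exists_repr z
  refine ⟨a, b, c, hc, ?_, rfl⟩
  by_contra! h0
  rw [h0.1, h0.2] at hz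
  simp at hz

variable {H}

section Finite

variable {𝔓 : Place K H.FunctionField}

/-- The use of `char K ≠ 2` at the places: it separates `y = v` from `y = -v` wherever `y` does not
vanish. -/
theorem val_two_mul (𝔓 : Place K H.FunctionField) (z : H.FunctionField) :
    𝔓.val (2 * z) = 𝔓.val z := by
  have h := 𝔓.val_algebraMap H.two_ne_zero
  rw [map_ofNat] at h
  rw [map_mul, h, one_mul]

variable (h𝔓 : ¬ H.IsInfinity 𝔓)
include h𝔓

theorem val_ofPolyHom_le_one (g : K[X]) : 𝔓.val (H.ofPolyHom g) ≤ 1 := by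
  rw [IsInfinity, not_not] at h𝔓
  rw [Place.val_le_one_iff]
  induction g using Polynomial.induction_on' with
  | add p q hp hq => rw [map_add]; exact add_mem hp hq
  | monomial n c =>
    rw [← C_mul_X_pow_eq_monomial, map_mul, map_pow]
    exact mul_mem (𝔓.base_lt.le ⟨c, rfl⟩) (pow_mem h𝔓 n)

theorem val_y_le_one : 𝔓.val H.y ≤ 1 := by
  have h := val_ofPolyHom_le_one h𝔓 H.f
  rw [← y_sq, map_pow] at h
  exact (pow_le_one_iff (by norm_num)).1 h

theorem val_add_mul_y_le_one (a b : K[X]) :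
    𝔓.val (H.ofPolyHom a + H.ofPolyHom b * H.y) ≤ 1 := by
  refine Valuation.map_add_le _ (val_ofPolyHom_le_one h𝔓 a) ?_
  rw [map_mul]
  exact mul_le_one' (val_ofPolyHom_le_one h𝔓 b) (val_y_le_one h𝔓)

/-- The irreducible polynomial below a finite place. -/
theorem exists_irreducible : ∃ π : K[X], Irreducible π ∧
    ∀ g, 𝔓.val (H.ofPolyHom g) < 1 ↔ π ∣ g := by
  let ψ : K[X] →+* 𝔓.ring := H.ofPolyHom.toRingHom.codRestrict 𝔓.ring.toSubring fun g =>
    𝔓.val_le_one_iff.1 (val_ofPolyHom_le_one h𝔓 g)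
  let I : Ideal K[X] := (IsLocalRing.maximalIdeal 𝔓.ring).comap ψ
  have hI (g : K[X]) : g ∈ I ↔ 𝔓.val (H.ofPolyHom g) < 1 := 𝔓.ring.valuation_lt_one_iff (ψ g)
  -- If no nonzero polynomial vanished at the place, all denominators would be units and the
  -- valuation ring would be the whole field.
  have hI0 : I ≠ ⊥ := by
    intro h0
    apply 𝔓.lt_top.ne
    rw [eq_top_iff]
    intro z _
    rw [← Place.val_le_one_iff]
    obtain ⟨a, b, c, hc, rfl⟩ := H.exists_repr z
    have h1 : 𝔓.val (H.ofPolyHom c) = 1 := by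
      refine le_antisymm (val_ofPolyHom_le_one h𝔓 c) ?_
      by_contra! h2
      rw [← hI, h0, Ideal.mem_bot] at h2
      exact hc h2
    rw [map_div₀, h1, div_one]
    exact val_add_mul_y_le_one h𝔓 a b
  have : I.IsPrime := Ideal.comap_isPrime _ _
  refine ⟨Submodule.IsPrincipal.generator I,
    (Submodule.IsPrincipal.prime_generator_of_isPrime I hI0).irreducible, fun g => ?_⟩
  rw [← hI, Submodule.IsPrincipal.mem_iff_generator_dvd]

end Finite

end GenusTwoCurve

/-! ### Uniformizers, uniqueness and existence of finite places. -/

namespace GenusTwoCurve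

variable {K : Type*} [Field K] {H : GenusTwoCurve K}

variable (H) in
/-- A uniformizer at the places over the irreducible polynomial `π`. -/
noncomputable def localParam (π : K[X]) : H.FunctionField :=
  open Classical in if π ∣ H.f then H.y else H.ofPolyHom π

/-- `z` is `t ^ n` times a quotient of two elements of the coordinate ring that are units
at the place. -/
def LocalForm (𝔓 : Place K H.FunctionField) (t z : H.FunctionField) : Prop :=
  ∃ n : ℤ, ∃ a b c d : K[X], 𝔓.val (H.ofPolyHom a + H.ofPolyHom b * H.y) = 1 ∧
    𝔓.val (H.ofPolyHom c + H.ofPolyHom d * H.y) = 1 ∧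
    z = t ^ n * ((H.ofPolyHom a + H.ofPolyHom b * H.y) / (H.ofPolyHom c + H.ofPolyHom d * H.y))

section

variable {𝔓 : Place K H.FunctionField} {t z w : H.FunctionField}

theorem add_mul_y_mul_add_mul_y (a b a' b' : K[X]) :
    (H.ofPolyHom a + H.ofPolyHom b * H.y) * (H.ofPolyHom a' + H.ofPolyHom b' * H.y) =
      H.ofPolyHom (a * a' + b * b' * H.f) + H.ofPolyHom (a * b' + a' * b) * H.y := by
  simp only [map_add, map_mul, ← y_sq]
  ring

theorem LocalForm.mul (ht : t ≠ 0) (hz : LocalForm 𝔓 t z) (hw : LocalForm 𝔓 t w) :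
    LocalForm 𝔓 t (z * w) := by
  obtain ⟨n, a, b, c, d, h1, h2, rfl⟩ := hz
  obtain ⟨n', a', b', c', d', h1', h2', rfl⟩ := hw
  refine ⟨n + n', a * a' + b * b' * H.f, a * b' + a' * b, c * c' + d * d' * H.f,
    c * d' + c' * d, ?_, ?_, ?_⟩
  rotate_left 2
  · rw [zpow_add₀ ht, mul_mul_mul_comm, div_mul_div_comm, add_mul_y_mul_add_mul_y, add_mul_y_mul_add_mul_y]
  · rw [← add_mul_y_mul_add_mul_y, map_mul, h1, h1', one_mul]
  · rw [← add_mul_y_mul_add_mul_y, map_mul, h2, h2', one_mul]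

theorem LocalForm.inv (hz : LocalForm 𝔓 t z) : LocalForm 𝔓 t z⁻¹ := by
  obtain ⟨n, a, b, c, d, h1, h2, rfl⟩ := hz
  exact ⟨-n, c, d, a, b, h2, h1, by rw [mul_inv, zpow_neg, inv_div]⟩

theorem LocalForm.of_val_eq_one {a b : K[X]}
    (h : 𝔓.val (H.ofPolyHom a + H.ofPolyHom b * H.y) = 1) :
    LocalForm 𝔓 t (H.ofPolyHom a + H.ofPolyHom b * H.y) :=
  ⟨0, a, b, 1, 0, h, by simp, by simp⟩

theorem LocalForm.of_val_eq_one' {a : K[X]} (h : 𝔓.val (H.ofPolyHom a) = 1) :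
    LocalForm 𝔓 t (H.ofPolyHom a) := by
  simpa using LocalForm.of_val_eq_one (t := t) (a := a) (b := 0) (by simpa using h)

theorem LocalForm.self : LocalForm 𝔓 t t := ⟨1, 1, 0, 1, 0, by simp, by simp, by simp⟩

theorem LocalForm.pow (ht : t ≠ 0) (hz : LocalForm 𝔓 t z) (k : ℕ) : LocalForm 𝔓 t (z ^ k) := by
  induction k with
  | zero => exact ⟨0, 1, 0, 1, 0, by simp, by simp, by simp⟩
  | succ k ih => rw [pow_succ]; exact ih.mul ht hz

variable (h𝔓 : ¬ H.IsInfinity 𝔓) {π : K[X]} (hπ : Irreducible π)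
  (h𝔓π : 𝔓.val (H.ofPolyHom π) < 1)
include h𝔓 hπ h𝔓π

theorem val_ofPolyHom_lt_one_iff (g : K[X]) : 𝔓.val (H.ofPolyHom g) < 1 ↔ π ∣ g := by
  obtain ⟨π', hπ', h⟩ := exists_irreducible h𝔓
  rw [h]
  exact (hπ'.associated_of_dvd hπ ((h π).1 h𝔓π)).dvd_iff_dvd_left

theorem val_ofPolyHom_eq_one_iff (g : K[X]) : 𝔓.val (H.ofPolyHom g) = 1 ↔ ¬ π ∣ g := by
  rw [← val_ofPolyHom_lt_one_iff h𝔓 hπ h𝔓π, not_lt]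
  exact ⟨fun h => h.ge, fun h => le_antisymm (val_ofPolyHom_le_one h𝔓 g) h⟩

theorem val_y_lt_one_iff : 𝔓.val H.y < 1 ↔ π ∣ H.f := by
  rw [← val_ofPolyHom_lt_one_iff h𝔓 hπ h𝔓π, ← y_sq, map_pow]
  exact (pow_lt_one_iff (by norm_num)).symm

/-- Squarefreeness of `f` makes the cofactor of `π` a unit, so `π` is `y²` up to a unit: the place
is ramified over the `x`-line. -/
theorem exists_eq_mul_of_dvd (h : π ∣ H.f) : ∃ g, H.f = π * g ∧ 𝔓.val (H.ofPolyHom g) = 1 ∧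
    H.ofPolyHom π = H.y ^ 2 * (H.ofPolyHom g)⁻¹ := by
  obtain ⟨g, hg⟩ := h
  have h1 : 𝔓.val (H.ofPolyHom g) = 1 := by
    rw [val_ofPolyHom_eq_one_iff h𝔓 hπ h𝔓π]
    rintro ⟨k, rfl⟩
    exact hπ.not_isUnit (H.squarefree_f π ⟨k, by rw [hg]; ring⟩)
  refine ⟨g, hg, h1, ?_⟩
  have h0 : H.ofPolyHom g ≠ 0 := by
    intro h0
    rw [h0, map_zero] at h1
    exact zero_ne_one h1
  rw [y_sq, hg, map_mul, mul_inv_cancel_right₀ h0]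

omit h𝔓 h𝔓π in
theorem localParam_ne_zero : H.localParam π ≠ 0 := by
  rw [localParam]
  split_ifs
  · exact H.y_ne_zero
  · exact H.ofPolyHom_ne_zero hπ.ne_zero

theorem val_localParam_lt_one : 𝔓.val (H.localParam π) < 1 := by
  rw [localParam]
  split_ifs with h
  · exact (val_y_lt_one_iff h𝔓 hπ h𝔓π).2 h
  · exact h𝔓π

theorem localForm_ofPolyHom {g : K[X]} (hg : g ≠ 0) :
    LocalForm 𝔓 (H.localParam π) (H.ofPolyHom g) := by
  have ht := localParam_ne_zero (H := H) hπ
  have h1 : LocalForm 𝔓 (H.localParam π) (H.ofPolyHom π) := by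
    by_cases h : π ∣ H.f
    · obtain ⟨k, -, hk, hk'⟩ := exists_eq_mul_of_dvd h𝔓 hπ h𝔓π h
      have h2 : H.localParam π = H.y := if_pos h
      rw [hk']
      refine LocalForm.mul ht (LocalForm.pow ht ?_ 2) (LocalForm.of_val_eq_one' hk).inv
      rw [h2]
      exact LocalForm.self
    · have h2 : H.localParam π = H.ofPolyHom π := if_neg h
      rw [← h2]
      exact LocalForm.self
  obtain ⟨k, hk, hd⟩ := (FiniteMultiplicity.of_not_isUnit hπ.not_isUnit
    hg).exists_eq_pow_mul_and_not_dvd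
  rw [hk, map_mul, map_pow]
  exact (h1.pow ht _).mul ht
    (LocalForm.of_val_eq_one' ((val_ofPolyHom_eq_one_iff h𝔓 hπ h𝔓π _).2 hd))

/-- Suppose that `a + b y` vanishes at the place. If `π ∣ f`, then `y` vanishes, hence so does `a`,
and one factor `y` can be pulled out, leaving a unit. If `π ∤ f`, then `y` is a unit and the
conjugate `a - b y` cannot vanish as well, since `π` would divide both `a` and `b`. This reduces the
claim to the norm, a polynomial in `x`. -/
theorem localForm_of_isCoprime {a b : K[X]} (hab : IsCoprime a b) :
    LocalForm 𝔓 (H.localParam π) (H.ofPolyHom a + H.ofPolyHom b * H.y) := by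
  have ht := localParam_ne_zero (H := H) hπ
  rcases (val_add_mul_y_le_one h𝔓 a b).eq_or_lt with h | h
  · exact LocalForm.of_val_eq_one h
  have hnot : ¬ (π ∣ a ∧ π ∣ b) := fun h => hπ.not_isUnit (hab.isUnit_of_dvd' h.1 h.2)
  by_cases hf : π ∣ H.f
  · have hy := (val_y_lt_one_iff h𝔓 hπ h𝔓π).2 hf
    have hby : 𝔓.val (H.ofPolyHom b * H.y) < 1 := by
      exact 𝔓.val_mul_lt_one (val_ofPolyHom_le_one h𝔓 b) hy
    have ha : 𝔓.val (H.ofPolyHom a) < 1 := by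
      have := Valuation.map_sub_lt _ h hby
      rwa [add_sub_cancel_right] at this
    obtain ⟨a', rfl⟩ := (val_ofPolyHom_lt_one_iff h𝔓 hπ h𝔓π a).1 ha
    have hb := (val_ofPolyHom_eq_one_iff h𝔓 hπ h𝔓π b).2 fun h => hnot ⟨dvd_mul_right _ _, h⟩
    obtain ⟨g, -, hg, hg'⟩ := exists_eq_mul_of_dvd h𝔓 hπ h𝔓π hf
    have hg0 : H.ofPolyHom g ≠ 0 := by
      intro h0
      rw [h0, map_zero] at hg
      exact zero_ne_one hg
    have h2 : H.localParam π = H.y := if_pos hf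
    -- Substitution of `π = y² / g`. The term `b g` is a unit and `a' y` vanishes at the place.
    have key : H.ofPolyHom (π * a') + H.ofPolyHom b * H.y =
        H.localParam π * ((H.ofPolyHom (b * g) + H.ofPolyHom a' * H.y) * (H.ofPolyHom g)⁻¹) := by
      rw [h2, map_mul, hg', map_mul]
      field_simp
      ring
    rw [key]
    refine LocalForm.self.mul ht ((LocalForm.of_val_eq_one ?_).mul ht
      (LocalForm.of_val_eq_one' hg).inv)
    have h3 : 𝔓.val (H.ofPolyHom (b * g)) = 1 := by rw [map_mul, map_mul, hb, hg, one_mul]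
    rw [Valuation.map_add_eq_of_lt_left, h3]
    rw [h3]
    exact 𝔓.val_mul_lt_one (val_ofPolyHom_le_one h𝔓 a') hy
  · have hy : 𝔓.val H.y = 1 := (val_y_le_one h𝔓).antisymm
      (not_lt.1 fun h => hf ((val_y_lt_one_iff h𝔓 hπ h𝔓π).1 h))
    have h1 : 𝔓.val (H.ofPolyHom a - H.ofPolyHom b * H.y) = 1 := by
      have h2 := val_add_mul_y_le_one h𝔓 a (-b)
      rw [map_neg, neg_mul, ← sub_eq_add_neg] at h2
      refine h2.antisymm (not_lt.1 fun h3 => hnot ?_)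
      constructor
      · rw [← val_ofPolyHom_lt_one_iff h𝔓 hπ h𝔓π, ← val_two_mul]
        have := Valuation.map_add_lt _ h h3
        rwa [add_add_sub_cancel, ← two_mul] at this
      · rw [← val_ofPolyHom_lt_one_iff h𝔓 hπ h𝔓π, ← val_two_mul]
        have := Valuation.map_sub_lt _ h h3
        rwa [add_sub_sub_cancel, ← two_mul, ← mul_assoc, map_mul, hy, mul_one] at this
    have h0 : H.ofPolyHom a - H.ofPolyHom b * H.y ≠ 0 := by
      intro h0
      rw [h0, map_zero] at h1
      exact zero_ne_one h1
    rw [eq_div_of_mul_eq h0 (H.add_mul_sub a b), div_eq_mul_inv]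
    refine (localForm_ofPolyHom h𝔓 hπ h𝔓π (H.norm_ne_zero ?_)).mul ht ?_
    · by_contra! h4
      rw [h4.1, h4.2] at h0
      simp at h0
    · have := LocalForm.of_val_eq_one (t := H.localParam π) (𝔓 := 𝔓) (a := a) (b := -b)
        (by rwa [map_neg, neg_mul, ← sub_eq_add_neg])
      rw [map_neg, neg_mul, ← sub_eq_add_neg] at this
      exact this.inv

theorem localForm (hz : z ≠ 0) : LocalForm 𝔓 (H.localParam π) z := by
  have ht := localParam_ne_zero (H := H) hπ
  obtain ⟨a, b, c, hc, hab, rfl⟩ := H.exists_repr_ne_zero hz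
  classical
  have hd : EuclideanDomain.gcd a b ≠ 0 := by
    rw [Ne, EuclideanDomain.gcd_eq_zero_iff]
    tauto
  obtain ⟨a', ha'⟩ := EuclideanDomain.gcd_dvd_left a b
  obtain ⟨b', hb'⟩ := EuclideanDomain.gcd_dvd_right a b
  generalize hg : EuclideanDomain.gcd a b = d at *
  have hcop : IsCoprime a' b' := by
    have hg' := EuclideanDomain.gcd_eq_gcd_ab a b
    refine ⟨EuclideanDomain.gcdA a b, EuclideanDomain.gcdB a b, mul_left_cancel₀ hd ?_⟩
    rw [hg] at hg'
    calc _ = (d * a') * EuclideanDomain.gcdA a b + (d * b') * EuclideanDomain.gcdB a b := by ring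
      _ = d * 1 := by rw [← ha', ← hb', ← hg', mul_one]
  have h1 : H.ofPolyHom a + H.ofPolyHom b * H.y =
      H.ofPolyHom d * (H.ofPolyHom a' + H.ofPolyHom b' * H.y) := by
    rw [ha', hb', map_mul, map_mul]
    ring
  rw [div_eq_mul_inv, h1]
  exact ((localForm_ofPolyHom h𝔓 hπ h𝔓π hd).mul ht
    (localForm_of_isCoprime h𝔓 hπ h𝔓π hcop)).mul ht (localForm_ofPolyHom h𝔓 hπ h𝔓π hc).inv

theorem isUniformizer_localParam : 𝔓.IsUniformizer (H.localParam π) where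
  ne_zero := localParam_ne_zero hπ
  val_lt_one := val_localParam_lt_one h𝔓 hπ h𝔓π
  exists_eq_zpow z hz := by
    obtain ⟨n, a, b, c, d, h1, h2, rfl⟩ := localForm h𝔓 hπ h𝔓π hz
    exact ⟨n, by rw [map_mul, map_div₀, h1, h2, div_one, mul_one, map_zpow₀]⟩

/-! ### The place over `(π, y - v)` -/

variable {v : K[X]} (h𝔓v : 𝔓.val (H.y - H.ofPolyHom v) < 1)
include h𝔓v

omit hπ h𝔓π in
theorem val_reduce (a b : K[X]) :
    𝔓.val ((H.ofPolyHom a + H.ofPolyHom b * H.y) - H.ofPolyHom (a + b * v)) < 1 := by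
  have : (H.ofPolyHom a + H.ofPolyHom b * H.y) - H.ofPolyHom (a + b * v) =
      H.ofPolyHom b * (H.y - H.ofPolyHom v) := by
    rw [map_add, map_mul]
    ring
  rw [this]
  exact 𝔓.val_mul_lt_one (val_ofPolyHom_le_one h𝔓 b) h𝔓v

theorem val_add_mul_y_eq_one_iff (a b : K[X]) :
    𝔓.val (H.ofPolyHom a + H.ofPolyHom b * H.y) = 1 ↔ ¬ π ∣ a + b * v := by
  have h := val_reduce h𝔓 h𝔓v a b
  rw [← val_ofPolyHom_eq_one_iff h𝔓 hπ h𝔓π]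
  constructor
  · intro h1
    rw [← h1]
    rw [← h1, Valuation.map_sub_swap] at h
    exact Valuation.map_eq_of_sub_lt _ h
  · intro h1
    rw [← h1]
    rw [← h1] at h
    exact Valuation.map_eq_of_sub_lt _ h

/-- Whether `a + b y` is a unit is decided by whether `π ∣ a + b v`, independently of the place. A
local form found at `𝔓` is therefore valid at `𝔔` with the same exponent, and its sign decides
membership in both valuation rings. -/
theorem place_unique {𝔔 : Place K H.FunctionField} (h𝔔 : ¬ H.IsInfinity 𝔔)
    (h𝔔π : 𝔔.val (H.ofPolyHom π) < 1) (h𝔔v : 𝔔.val (H.y - H.ofPolyHom v) < 1) : 𝔓 = 𝔔 := by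
  apply Place.ext_val
  intro z
  by_cases hz : z = 0
  · simp [hz]
  obtain ⟨n, a, b, c, d, h1, h2, rfl⟩ := localForm h𝔓 hπ h𝔓π hz
  have h1' : 𝔔.val (H.ofPolyHom a + H.ofPolyHom b * H.y) = 1 := by
    rw [val_add_mul_y_eq_one_iff h𝔔 hπ h𝔔π h𝔔v]
    rwa [val_add_mul_y_eq_one_iff h𝔓 hπ h𝔓π h𝔓v] at h1
  have h2' : 𝔔.val (H.ofPolyHom c + H.ofPolyHom d * H.y) = 1 := by
    rw [val_add_mul_y_eq_one_iff h𝔔 hπ h𝔔π h𝔔v]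
    rwa [val_add_mul_y_eq_one_iff h𝔓 hπ h𝔓π h𝔓v] at h2
  have h3 := isUniformizer_localParam h𝔓 hπ h𝔓π
  have h4 := isUniformizer_localParam h𝔔 hπ h𝔔π
  rw [map_mul, map_div₀, h1, h2, map_mul, map_div₀, h1', h2', div_one, div_one, mul_one, mul_one,
    map_zpow₀, map_zpow₀, ← zpow_zero (𝔓.val (H.localParam π)),
    ← zpow_zero (𝔔.val (H.localParam π))]
  exact h3.strictAnti.le_iff_ge.trans h4.strictAnti.le_iff_ge.symm

theorem degree_place : 𝔓.degree = π.natDegree := by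
  refine 𝔓.degree_eq (not_not.1 h𝔓) hπ (fun g => ?_) fun z hz => ?_
  · rw [aeval_x]
    exact val_ofPolyHom_lt_one_iff h𝔓 hπ h𝔓π g
  rcases hz.lt_or_eq with hz | hz
  · exact ⟨0, by simpa using hz⟩
  have hz0 : z ≠ 0 := by
    rintro rfl
    simp at hz
  have ht := isUniformizer_localParam h𝔓 hπ h𝔓π
  obtain ⟨n, a, b, c, d, h1, h2, rfl⟩ := localForm h𝔓 hπ h𝔓π hz0
  have hn : n = 0 := by
    rw [map_mul, map_div₀, h1, h2, div_one, mul_one, map_zpow₀,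
      ← zpow_zero (𝔓.val (H.localParam π))] at hz
    exact ht.strictAnti.injective hz
  have hq := (val_add_mul_y_eq_one_iff h𝔓 hπ h𝔓π h𝔓v _ _).1 h2
  have h3 := val_reduce h𝔓 h𝔓v a b
  have h4 := val_reduce h𝔓 h𝔓v c d
  generalize hα : H.ofPolyHom a + H.ofPolyHom b * H.y = α at *
  generalize hβ : H.ofPolyHom c + H.ofPolyHom d * H.y = β at *
  generalize a + b * v = p at *
  generalize c + d * v = q at *
  obtain ⟨e, r, her⟩ := (hπ.coprime_iff_not_dvd).2 hq
  have hβ0 : β ≠ 0 := by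
    rintro rfl
    simp at h2
  -- Modulo the place, `α / β` is `p / q`, and `r` inverts `q` modulo `π`.
  refine ⟨p * r, ?_⟩
  rw [aeval_x]
  have key : H.localParam π ^ n * (α / β) - H.ofPolyHom (p * r) =
      ((α - H.ofPolyHom p) - (β - H.ofPolyHom q) * H.ofPolyHom (p * r)
        + H.ofPolyHom (p * e) * H.ofPolyHom π) / β := by
    have her' := congrArg H.ofPolyHom her
    rw [map_add, map_mul, map_mul, map_one] at her'
    rw [hn, zpow_zero, one_mul, map_mul, map_mul]
    field_simp
    linear_combination -H.ofPolyHom p * her'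
  rw [key, map_div₀, h2, div_one]
  refine Valuation.map_add_lt _ (Valuation.map_sub_lt _ h3 ?_) ?_
  · rw [mul_comm]
    exact 𝔓.val_mul_lt_one (val_ofPolyHom_le_one h𝔓 _) h4
  · rw [map_mul]
    exact 𝔓.val_mul_lt_one (val_ofPolyHom_le_one h𝔓 _) h𝔓π

end

/-- The ideal `(π, y - v)` of `K[x, y]` is proper, so some valuation ring contains `K[x, y]` and has
this ideal among its nonunits. -/
theorem exists_place {π v : K[X]} (hπ : Irreducible π) (hv : π ∣ H.f - v ^ 2) :
    ∃ 𝔓 : Place K H.FunctionField, ¬ H.IsInfinity 𝔓 ∧ 𝔓.val (H.ofPolyHom π) < 1 ∧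
      𝔓.val (H.y - H.ofPolyHom v) < 1 := by
  let A : Subring H.FunctionField := (algebraMap H.CoordinateRing H.FunctionField).range
  have hx (g : K[X]) : H.ofPolyHom g ∈ A := ⟨_, rfl⟩
  have hy : H.y ∈ A := ⟨_, rfl⟩
  let p : A := ⟨H.ofPolyHom π, hx π⟩
  let w : A := ⟨H.y - H.ofPolyHom v, sub_mem hy (hx v)⟩
  have hI : Ideal.span {p, w} ≠ ⊤ := by
    rw [Ne, Ideal.eq_top_iff_one, Ideal.mem_span_pair]
    rintro ⟨⟨α, α', rfl⟩, ⟨β, β', rfl⟩, h⟩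
    have h' := congrArg Subtype.val h
    push_cast at h'
    obtain ⟨a, b, h1⟩ := H.exists_coordinateRing_repr α'
    obtain ⟨c, d, h2⟩ := H.exists_coordinateRing_repr β'
    rw [h1, h2] at h'
    have h3 : H.ofPolyHom (a * π - c * v + d * H.f - 1) +
        H.ofPolyHom (b * π + c - d * v) * H.y = 0 := by
      simp only [map_add, map_sub, map_mul, map_one, ← y_sq]
      linear_combination h'
    have h4 : a * π - c * v + d * H.f - 1 = 0 ∧ b * π + c - d * v = 0 := by
      by_contra h5
      exact H.add_mul_y_ne_zero (by tauto) h3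
    obtain ⟨k, hk⟩ := hv
    apply hπ.not_isUnit
    rw [isUnit_iff_dvd_one]
    -- The cofactor obtained by putting `y = v` in the relation that expresses `1`; the term `d k`
    -- accounts for `f - v² = π k`.
    refine ⟨a + b * v + d * k, ?_⟩
    linear_combination -h4.1 - v * h4.2 + d * hk
  obtain ⟨B, hAB, hIB⟩ := Ideal.image_subset_nonunits_valuationSubring _ hI
  have hpB : H.ofPolyHom π ∈ B.nonunits := hIB ⟨p, Ideal.subset_span (by simp), rfl⟩
  have hwB : H.y - H.ofPolyHom v ∈ B.nonunits := hIB ⟨w, Ideal.subset_span (by simp), rfl⟩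
  have hxB : H.x ∈ B := hAB (hx X)
  refine ⟨⟨B, ?_, ?_⟩, not_not.2 hxB, hpB, hwB⟩
  · refine SetLike.lt_iff_le_and_exists.2 ⟨?_, H.x, hxB, ?_⟩
    · rintro _ ⟨c, rfl⟩
      exact hAB (hx (C c))
    · rintro ⟨c, hc⟩
      have : H.ofPolyHom (X - C c) = 0 := by
        rw [map_sub, ofPolyHom_X, ofPolyHom_C, ← hc]
        exact sub_self _
      exact H.ofPolyHom_ne_zero (X_sub_C_ne_zero c) this
  · refine lt_top_iff_ne_top.2 ?_
    rintro rfl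
    have h1 := (ValuationSubring.mem_nonunits_iff _).1 hpB
    have h2 : (⊤ : ValuationSubring H.FunctionField).valuation (H.ofPolyHom π)⁻¹ ≤ 1 :=
      (ValuationSubring.valuation_le_one_iff _ _).2 trivial
    rw [map_inv₀] at h2
    have h3 : 0 < (⊤ : ValuationSubring H.FunctionField).valuation (H.ofPolyHom π) := by
      rw [zero_lt_iff, Ne, map_eq_zero]
      exact H.ofPolyHom_ne_zero hπ.ne_zero
    exact h1.not_ge ((inv_le_one₀ h3).1 h2)

end GenusTwoCurve

namespace GenusTwoCurve

variable {K : Type*} [Field K] {H : GenusTwoCurve K}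

/-! ### The place at infinity -/

section Infinite

variable (H) in
/-- A uniformizer at infinity. -/
noncomputable def infParam : H.FunctionField := H.x ^ 2 / H.y

variable {𝔓 : Place K H.FunctionField} (h𝔓 : H.IsInfinity 𝔓)
include h𝔓

theorem one_lt_val_x : 1 < 𝔓.val H.x := by
  rw [← not_le, Place.val_le_one_iff]
  exact h𝔓

theorem val_ofPolyHom_eq_pow {g : K[X]} (hg : g ≠ 0) :
    𝔓.val (H.ofPolyHom g) = 𝔓.val H.x ^ g.natDegree := by
  have : Valuation.IsTrivialOn K 𝔓.val := ⟨fun c hc => 𝔓.val_algebraMap hc⟩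
  rw [← aeval_x]
  exact valuation_aeval_eq_valuation_X_pow_natDegree_of_one_lt_valuation_X H.x
    (one_lt_val_x h𝔓) hg

/-- The square of the parameter is `x⁴ / f`, and `f` has the value of `x⁵`. -/
theorem val_infParam_sq : 𝔓.val H.infParam ^ 2 = (𝔓.val H.x)⁻¹ := by
  have h0 : 𝔓.val H.x ≠ 0 := (zero_lt_one.trans (one_lt_val_x h𝔓)).ne'
  rw [infParam, map_div₀, div_pow, ← map_pow (Place.val 𝔓) H.y, y_sq,
    val_ofPolyHom_eq_pow h𝔓 H.f_ne_zero, H.natDegree_f, map_pow]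
  field_simp

theorem infParam_ne_zero : H.infParam ≠ 0 := by
  intro h
  have := val_infParam_sq h𝔓
  rw [h, map_zero, zero_pow (by norm_num), eq_comm, inv_eq_zero] at this
  have h1 := one_lt_val_x h𝔓
  rw [this] at h1
  exact not_lt_zero h1

theorem val_infParam_lt_one : 𝔓.val H.infParam < 1 := by
  rw [← pow_lt_one_iff (n := 2) (by norm_num), val_infParam_sq h𝔓]
  exact inv_lt_one_of_one_lt₀ (one_lt_val_x h𝔓)

theorem val_infParam_ne_zero : 𝔓.val H.infParam ≠ 0 := by
  rw [Ne, map_eq_zero]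
  exact infParam_ne_zero h𝔓

theorem val_x_eq : 𝔓.val H.x = 𝔓.val H.infParam ^ (-2 : ℤ) := by
  rw [zpow_neg, zpow_ofNat, val_infParam_sq h𝔓, inv_inv]

theorem val_ofPolyHom_eq_zpow {g : K[X]} (hg : g ≠ 0) :
    𝔓.val (H.ofPolyHom g) = 𝔓.val H.infParam ^ (-2 * (g.natDegree : ℤ)) := by
  rw [val_ofPolyHom_eq_pow h𝔓 hg, val_x_eq h𝔓, zpow_mul, zpow_natCast]

theorem val_y_eq : 𝔓.val H.y = 𝔓.val H.infParam ^ (-5 : ℤ) := by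
  have h0 := val_infParam_ne_zero h𝔓
  have h1 : H.y = H.x ^ 2 / H.infParam := by
    rw [infParam, div_div_cancel₀]
    intro h
    have := infParam_ne_zero h𝔓
    rw [infParam, h, zero_div] at this
    exact this rfl
  rw [h1, map_div₀, map_pow, val_x_eq h𝔓, ← zpow_natCast, ← zpow_mul, div_eq_mul_inv,
    ← zpow_neg_one, ← zpow_add₀ h0]
  norm_num

theorem val_infParam_strictAnti : StrictAnti fun n : ℤ => 𝔓.val H.infParam ^ n :=
  zpow_right_strictAnti₀ (zero_lt_iff.2 (val_infParam_ne_zero h𝔓)) (val_infParam_lt_one h𝔓)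

theorem val_ofPolyHom_mul_y {b : K[X]} (hb : b ≠ 0) :
    𝔓.val (H.ofPolyHom b * H.y) = 𝔓.val H.infParam ^ (-2 * (b.natDegree : ℤ) - 5) := by
  rw [map_mul, val_ofPolyHom_eq_zpow h𝔓 hb, val_y_eq h𝔓, sub_eq_add_neg,
    zpow_add₀ (val_infParam_ne_zero h𝔓)]

theorem val_add_mul_y_of_lt {a b : K[X]} (ha : a ≠ 0)
    (h : b = 0 ∨ 2 * b.natDegree + 5 < 2 * a.natDegree) :
    𝔓.val (H.ofPolyHom b * H.y) < 𝔓.val (H.ofPolyHom a) ∧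
    𝔓.val (H.ofPolyHom a + H.ofPolyHom b * H.y) =
      𝔓.val H.infParam ^ (-2 * (a.natDegree : ℤ)) := by
  have h1 : 𝔓.val (H.ofPolyHom b * H.y) < 𝔓.val (H.ofPolyHom a) := by
    by_cases hb : b = 0
    · rw [hb, map_zero, zero_mul, map_zero, zero_lt_iff, Ne, map_eq_zero]
      exact H.ofPolyHom_ne_zero ha
    · rw [val_ofPolyHom_mul_y h𝔓 hb, val_ofPolyHom_eq_zpow h𝔓 ha]
      exact val_infParam_strictAnti h𝔓 (by have := h.resolve_left hb; omega)
  refine ⟨h1, ?_⟩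
  rw [← val_ofPolyHom_eq_zpow h𝔓 ha]
  exact Valuation.map_add_eq_of_lt_left _ h1

theorem val_add_mul_y_of_gt {a b : K[X]} (hb : b ≠ 0)
    (h : a = 0 ∨ 2 * a.natDegree < 2 * b.natDegree + 5) :
    𝔓.val (H.ofPolyHom a + H.ofPolyHom b * H.y) =
      𝔓.val H.infParam ^ (-2 * (b.natDegree : ℤ) - 5) := by
  rw [← val_ofPolyHom_mul_y h𝔓 hb]
  refine Valuation.map_add_eq_of_lt_right _ ?_
  by_cases ha : a = 0
  · rw [ha, map_zero, map_zero, zero_lt_iff, Ne, map_eq_zero]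
    exact mul_ne_zero (H.ofPolyHom_ne_zero hb) H.y_ne_zero
  · rw [val_ofPolyHom_mul_y h𝔓 hb, val_ofPolyHom_eq_zpow h𝔓 ha]
    exact val_infParam_strictAnti h𝔓 (by have := h.resolve_left ha; omega)

omit h𝔓 in
theorem natDegree_lt_or_gt {a b : K[X]} (h : a ≠ 0 ∨ b ≠ 0) :
    (a ≠ 0 ∧ (b = 0 ∨ 2 * b.natDegree + 5 < 2 * a.natDegree)) ∨
      (b ≠ 0 ∧ (a = 0 ∨ 2 * a.natDegree < 2 * b.natDegree + 5)) := by
  by_cases ha : a = 0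
  · exact Or.inr ⟨h.resolve_left (not_not.2 ha), Or.inl ha⟩
  by_cases hb : b = 0
  · exact Or.inl ⟨ha, Or.inl hb⟩
  rcases lt_trichotomy (2 * b.natDegree + 5) (2 * a.natDegree) with h | h | h
  · exact Or.inl ⟨ha, Or.inr h⟩
  · omega
  · exact Or.inr ⟨hb, Or.inr h⟩

-- Polynomials have even order and `b y` has odd order, so `a + b y` has the smaller of the two
-- orders. The exponent depends on degrees only, which is why it can be chosen before the place;
-- uniqueness of the place at infinity follows.
omit h𝔓 in
theorem exists_val_eq_zpow {z : H.FunctionField} (hz : z ≠ 0) : ∃ n : ℤ,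
    ∀ 𝔓 : Place K H.FunctionField, H.IsInfinity 𝔓 → 𝔓.val z = 𝔓.val H.infParam ^ n := by
  obtain ⟨a, b, c, hc, hab, rfl⟩ := H.exists_repr_ne_zero hz
  rcases natDegree_lt_or_gt hab with h | h
  · refine ⟨-2 * (a.natDegree : ℤ) - -2 * (c.natDegree : ℤ), fun 𝔓 h𝔓 => ?_⟩
    rw [map_div₀, (val_add_mul_y_of_lt h𝔓 h.1 h.2).2, val_ofPolyHom_eq_zpow h𝔓 hc,
      ← zpow_sub₀ (val_infParam_ne_zero h𝔓)]
  · refine ⟨(-2 * (b.natDegree : ℤ) - 5) - -2 * (c.natDegree : ℤ), fun 𝔓 h𝔓 => ?_⟩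
    rw [map_div₀, val_add_mul_y_of_gt h𝔓 h.1 h.2, val_ofPolyHom_eq_zpow h𝔓 hc,
      ← zpow_sub₀ (val_infParam_ne_zero h𝔓)]

theorem isUniformizer_infParam : 𝔓.IsUniformizer H.infParam where
  ne_zero := infParam_ne_zero h𝔓
  val_lt_one := val_infParam_lt_one h𝔓
  exists_eq_zpow _ hz := by
    obtain ⟨n, hn⟩ := exists_val_eq_zpow hz
    exact ⟨n, hn 𝔓 h𝔓⟩

theorem infinity_unique {𝔔 : Place K H.FunctionField} (h𝔔 : H.IsInfinity 𝔔) : 𝔓 = 𝔔 := by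
  apply Place.ext_val
  intro z
  by_cases hz : z = 0
  · simp [hz]
  obtain ⟨n, hn⟩ := exists_val_eq_zpow hz
  rw [hn 𝔓 h𝔓, hn 𝔔 h𝔔, ← zpow_zero (𝔓.val H.infParam), ← zpow_zero (𝔔.val H.infParam)]
  exact (val_infParam_strictAnti h𝔓).le_iff_ge.trans (val_infParam_strictAnti h𝔔).le_iff_ge.symm

theorem degree_infinity : 𝔓.degree = 1 := by
  rw [← natDegree_X (R := K)]
  have haeval (g : K[X]) : aeval (0 : H.FunctionField) g = algebraMap K _ (g.coeff 0) :=
    (coeff_zero_eq_aeval_zero' g).symm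
  -- The residue field is to be `K = K[X]/(X)`, so the generator `0` suffices.
  refine 𝔓.degree_eq (w := 0) (zero_mem _) irreducible_X (fun g => ?_) fun z hz => ?_
  · rw [X_dvd_iff, haeval]
    constructor
    · intro h
      by_contra h1
      rw [𝔓.val_algebraMap h1] at h
      exact lt_irrefl _ h
    · intro h
      rw [h, map_zero, map_zero]
      exact zero_lt_one
  suffices ∃ k : K, 𝔓.val (z - algebraMap K _ k) < 1 by
    obtain ⟨k, hk⟩ := this
    exact ⟨C k, by rwa [aeval_C]⟩
  rcases hz.lt_or_eq with hz | hz
  · exact ⟨0, by simpa using hz⟩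
  have hz0 : z ≠ 0 := by
    rintro rfl
    simp at hz
  obtain ⟨a, b, c, hc, hab, rfl⟩ := H.exists_repr_ne_zero hz0
  have hc0 := H.ofPolyHom_ne_zero hc
  have hvc0 : 𝔓.val (H.ofPolyHom c) ≠ 0 := (_root_.map_ne_zero _).2 hc0
  have hvc := val_ofPolyHom_eq_zpow h𝔓 hc
  rw [map_div₀, div_eq_one_iff_eq hvc0, hvc] at hz
  have hinj := (val_infParam_strictAnti h𝔓).injective
  rcases natDegree_lt_or_gt hab with h | h
  · obtain ⟨h1, h2⟩ := val_add_mul_y_of_lt h𝔓 h.1 h.2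
    have hdeg : a.natDegree = c.natDegree := by
      have := hinj (h2.symm.trans hz)
      omega
    -- The value at infinity is the quotient of the leading coefficients, since `b y` is negligible
    -- against `a`.
    refine ⟨a.leadingCoeff / c.leadingCoeff, ?_⟩
    have hlc : c.leadingCoeff ≠ 0 := leadingCoeff_ne_zero.2 hc
    have hla : a.leadingCoeff ≠ 0 := leadingCoeff_ne_zero.2 h.1
    have hva : 𝔓.val (H.ofPolyHom a) = 𝔓.val (H.ofPolyHom c) := by
      rw [hvc, val_ofPolyHom_eq_zpow h𝔓 h.1, hdeg]
    set k := a.leadingCoeff / c.leadingCoeff with hk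
    have hk0 : k ≠ 0 := div_ne_zero hla hlc
    have hlow : 𝔓.val (H.ofPolyHom (a - C k * c)) < 𝔓.val (H.ofPolyHom c) := by
      by_cases h0 : a - C k * c = 0
      · rw [h0, map_zero, map_zero]
        exact zero_lt_iff.2 hvc0
      · rw [val_ofPolyHom_eq_pow h𝔓 h0, val_ofPolyHom_eq_pow h𝔓 hc, ← hdeg]
        refine pow_lt_pow_right₀ (one_lt_val_x h𝔓) ?_
        refine natDegree_lt_natDegree h0 (degree_sub_lt_left ?_ h.1 ?_)
        · rw [degree_C_mul hk0, degree_eq_natDegree h.1, degree_eq_natDegree hc, hdeg]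
        · rw [leadingCoeff_mul, leadingCoeff_C, hk, div_mul_cancel₀ _ hlc]
    have key : (H.ofPolyHom a + H.ofPolyHom b * H.y) / H.ofPolyHom c - algebraMap K _ k =
        (H.ofPolyHom (a - C k * c) + H.ofPolyHom b * H.y) / H.ofPolyHom c := by
      rw [map_sub, map_mul, ofPolyHom_C]
      field_simp
      ring
    rw [key, map_div₀, div_lt_one₀ (zero_lt_iff.2 hvc0)]
    exact Valuation.map_add_lt _ hlow (h1.trans_eq hva)
  -- If `b y` dominates, the order of the quotient is odd and hence not zero.
  · have h2 := val_add_mul_y_of_gt h𝔓 h.1 h.2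
    have := hinj (h2.symm.trans hz)
    omega

end Infinite

/-! ### Orders -/

theorem exists_isUniformizer (𝔓 : Place K H.FunctionField) : ∃ t, 𝔓.IsUniformizer t := by
  by_cases h𝔓 : H.IsInfinity 𝔓
  · exact ⟨_, isUniformizer_infParam h𝔓⟩
  · obtain ⟨π, hπ, h⟩ := exists_irreducible h𝔓
    exact ⟨_, isUniformizer_localParam h𝔓 hπ ((h π).2 dvd_rfl)⟩

section Orders

variable (𝔓 : Place K H.FunctionField) {z w : H.FunctionField}

theorem hasOrd_iff_ord (hz : z ≠ 0) {n : ℤ} : 𝔓.HasOrd z n ↔ 𝔓.ord z = n :=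
  (exists_isUniformizer 𝔓).choose_spec.hasOrd_iff_ord hz

theorem ord_mul (hz : z ≠ 0) (hw : w ≠ 0) : 𝔓.ord (z * w) = 𝔓.ord z + 𝔓.ord w :=
  (exists_isUniformizer 𝔓).choose_spec.ord_mul hz hw

theorem ord_nonneg_iff (hz : z ≠ 0) : 0 ≤ 𝔓.ord z ↔ 𝔓.val z ≤ 1 :=
  (exists_isUniformizer 𝔓).choose_spec.ord_nonneg_iff hz

theorem ord_pos_iff (hz : z ≠ 0) : 0 < 𝔓.ord z ↔ 𝔓.val z < 1 :=
  (exists_isUniformizer 𝔓).choose_spec.ord_pos_iff hz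

theorem ord_add (hz : z ≠ 0) (hw : w ≠ 0) (h : 𝔓.ord z < 𝔓.ord w) :
    𝔓.ord (z + w) = 𝔓.ord z :=
  (exists_isUniformizer 𝔓).choose_spec.ord_add hz hw h

theorem ord_eq_zero (h : 𝔓.val z = 1) : 𝔓.ord z = 0 :=
  (exists_isUniformizer 𝔓).choose_spec.ord_eq_of_val_eq (by rw [h, zpow_zero])

theorem ord_neg (z : H.FunctionField) : 𝔓.ord (-z) = 𝔓.ord z := by
  by_cases hz : z = 0
  · rw [hz, neg_zero]
  · obtain ⟨t, ht⟩ := exists_isUniformizer 𝔓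
    refine ht.ord_eq_of_val_eq ?_
    rw [Valuation.map_neg, ht.val_eq hz]

end Orders

theorem ord_ofPolyHom_of_isInfinity {𝔓 : Place K H.FunctionField} (h𝔓 : H.IsInfinity 𝔓)
    {g : K[X]} (hg : g ≠ 0) : 𝔓.ord (H.ofPolyHom g) = -2 * g.natDegree :=
  (isUniformizer_infParam h𝔓).ord_eq_of_val_eq (val_ofPolyHom_eq_zpow h𝔓 hg)

theorem ord_y_of_isInfinity {𝔓 : Place K H.FunctionField} (h𝔓 : H.IsInfinity 𝔓) :
    𝔓.ord H.y = -5 :=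
  (isUniformizer_infParam h𝔓).ord_eq_of_val_eq (val_y_eq h𝔓)

/-! ### Ramification and the orders of `y - v` and `y + v`. -/

section Finite

variable {𝔓 : Place K H.FunctionField} (h𝔓 : ¬ H.IsInfinity 𝔓)
include h𝔓

theorem ord_ofPolyHom_nonneg {g : K[X]} (hg : g ≠ 0) : 0 ≤ 𝔓.ord (H.ofPolyHom g) :=
  (ord_nonneg_iff 𝔓 (H.ofPolyHom_ne_zero hg)).2 (val_ofPolyHom_le_one h𝔓 g)

theorem ord_y_sub_nonneg (v : K[X]) : 0 ≤ 𝔓.ord (H.y - H.ofPolyHom v) :=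
  (ord_nonneg_iff 𝔓 (H.y_sub_ne_zero v)).2
    (Valuation.map_sub_le _ (val_y_le_one h𝔓) (val_ofPolyHom_le_one h𝔓 v))

/-- Here `y` is a uniformizer and `π` is `y²` up to a unit, so the order of a polynomial is twice
its multiplicity at `π`. -/
theorem ord_ramified (hy : 𝔓.val H.y < 1) :
    𝔓.ord H.y = 1 ∧ ∀ g : K[X], g ≠ 0 → Even (𝔓.ord (H.ofPolyHom g)) := by
  obtain ⟨π, hπ, h⟩ := exists_irreducible h𝔓
  have h𝔓π := (h π).2 dvd_rfl
  have hf := (val_y_lt_one_iff h𝔓 hπ h𝔓π).1 hy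
  have ht := isUniformizer_localParam h𝔓 hπ h𝔓π
  rw [localParam, if_pos hf] at ht
  refine ⟨ht.ord_self, fun g hg => ?_⟩
  obtain ⟨k, hk, hd⟩ := (FiniteMultiplicity.of_not_isUnit hπ.not_isUnit
    hg).exists_eq_pow_mul_and_not_dvd
  obtain ⟨r, -, hr, hr'⟩ := exists_eq_mul_of_dvd h𝔓 hπ h𝔓π hf
  rw [ht.ord_eq_of_val_eq (n := 2 * (multiplicity π g : ℤ))]
  · exact even_two_mul _
  · nth_rewrite 1 [hk]
    rw [map_mul, map_mul, (val_ofPolyHom_eq_one_iff h𝔓 hπ h𝔓π k).2 hd, map_pow, map_pow, hr',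
      map_mul, map_inv₀, hr, inv_one, mul_one, mul_one, map_pow, zpow_mul, zpow_natCast]
    norm_cast

/-- A nonzero `v` has positive even order, thus at least two, and `y` of order one dominates. -/
theorem ord_y_sub_of_ramified (hy : 𝔓.val H.y < 1) {v : K[X]}
    (hv : 𝔓.val (H.ofPolyHom v) < 1) : 𝔓.ord (H.y - H.ofPolyHom v) = 1 := by
  obtain ⟨h1, h2⟩ := ord_ramified h𝔓 hy
  by_cases h0 : v = 0
  · rw [h0, map_zero, sub_zero, h1]
  have h3 := (ord_pos_iff 𝔓 (H.ofPolyHom_ne_zero h0)).2 hv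
  obtain ⟨k, hk⟩ := h2 v h0
  rw [sub_eq_add_neg, ord_add 𝔓 H.y_ne_zero (neg_ne_zero.2 (H.ofPolyHom_ne_zero h0)), h1]
  rw [ord_neg]
  omega

/-- If `y - v` and `y + v` both vanish, so do `2 y` and then `v`, and the place is ramified. -/
theorem ord_y_sub_trichotomy (v : K[X]) :
    𝔓.ord (H.y - H.ofPolyHom v) = 0 ∨ 𝔓.ord (H.y - H.ofPolyHom (-v)) = 0 ∨
      (𝔓.ord (H.y - H.ofPolyHom v) = 1 ∧ 𝔓.ord (H.y - H.ofPolyHom (-v)) = 1 ∧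
        ∀ g : K[X], g ≠ 0 → Even (𝔓.ord (H.ofPolyHom g))) := by
  by_cases hb : 𝔓.ord (H.y - H.ofPolyHom v) = 0
  · exact Or.inl hb
  by_cases hc : 𝔓.ord (H.y - H.ofPolyHom (-v)) = 0
  · exact Or.inr (Or.inl hc)
  have hb' := (ord_pos_iff 𝔓 (H.y_sub_ne_zero v)).1
    (lt_of_le_of_ne (ord_y_sub_nonneg h𝔓 v) (Ne.symm hb))
  have hc' := (ord_pos_iff 𝔓 (H.y_sub_ne_zero (-v))).1
    (lt_of_le_of_ne (ord_y_sub_nonneg h𝔓 (-v)) (Ne.symm hc))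
  have hy : 𝔓.val H.y < 1 := by
    rw [← val_two_mul]
    have := Valuation.map_add_lt _ hb' hc'
    rwa [map_neg, sub_neg_eq_add, sub_add_add_cancel, ← two_mul] at this
  have hv : 𝔓.val (H.ofPolyHom v) < 1 := by
    have := Valuation.map_sub_lt _ hy hb'
    rwa [sub_sub_cancel] at this
  refine Or.inr (Or.inr ⟨ord_y_sub_of_ramified h𝔓 hy hv, ord_y_sub_of_ramified h𝔓 hy ?_,
    (ord_ramified h𝔓 hy).2⟩)
  rwa [map_neg, Valuation.map_neg]

end Finite

theorem f_sub_sq_ne_zero (v : K[X]) : H.f - v ^ 2 ≠ 0 := by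
  have := H.norm_ne_zero (a := v) (b := 1) (Or.inr one_ne_zero)
  rw [one_pow, one_mul] at this
  exact sub_ne_zero.2 (sub_ne_zero.1 this).symm

theorem y_sub_mul_y_sub (v : K[X]) :
    (H.y - H.ofPolyHom v) * (H.y - H.ofPolyHom (-v)) = H.ofPolyHom (H.f - v ^ 2) := by
  rw [map_sub, map_neg, map_pow, ← y_sq]
  ring

theorem ord_y_sub_add_ord_y_sub (𝔓 : Place K H.FunctionField) (v : K[X]) :
    𝔓.ord (H.y - H.ofPolyHom v) + 𝔓.ord (H.y - H.ofPolyHom (-v)) =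
      𝔓.ord (H.ofPolyHom (H.f - v ^ 2)) := by
  rw [← y_sub_mul_y_sub, ord_mul 𝔓 (H.y_sub_ne_zero v) (H.y_sub_ne_zero (-v))]

/-- The multiplicity at a place of the divisor with Mumford representation `⟨u, v⟩`. -/
noncomputable def mumfordOrd (𝔓 : Place K H.FunctionField) (u v : K[X]) : ℤ :=
  min (𝔓.ord (H.ofPolyHom u)) (𝔓.ord (H.y - H.ofPolyHom v))

/-! ### Local rules for the multiplicities `mumfordOrd`. -/

section Mumford

variable {𝔓 : Place K H.FunctionField} (h𝔓 : ¬ H.IsInfinity 𝔓)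
include h𝔓

/-- If `y - v` is a unit, all the minima are zero. If `y + v` is a unit, `ord (y - v)` is at least
`ord u₁ + ord u₂`, and the minima are the orders of the polynomials. In the ramified case `f - v²`
has order two and `u₁`, `u₂` have even order, so at most one of them vanishes, and it contributes
one. -/
theorem mumfordOrd_mul {u₁ u₂ v : K[X]} (h : u₁ * u₂ ∣ H.f - v ^ 2) :
    mumfordOrd 𝔓 (u₁ * u₂) v = mumfordOrd 𝔓 u₁ v + mumfordOrd 𝔓 u₂ v := by
  obtain ⟨k, hk⟩ := h
  have h0 : u₁ * u₂ * k ≠ 0 := hk ▸ f_sub_sq_ne_zero v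
  have hk0 := right_ne_zero_of_mul h0
  have h1 := left_ne_zero_of_mul (left_ne_zero_of_mul h0)
  have h2 := right_ne_zero_of_mul (left_ne_zero_of_mul h0)
  have hs := ord_y_sub_add_ord_y_sub 𝔓 v
  rw [hk, map_mul, map_mul, ord_mul 𝔓 (mul_ne_zero (H.ofPolyHom_ne_zero h1)
    (H.ofPolyHom_ne_zero h2)) (H.ofPolyHom_ne_zero hk0), ord_mul 𝔓 (H.ofPolyHom_ne_zero h1)
    (H.ofPolyHom_ne_zero h2)] at hs
  rw [mumfordOrd, mumfordOrd, mumfordOrd, map_mul, ord_mul 𝔓 (H.ofPolyHom_ne_zero h1)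
    (H.ofPolyHom_ne_zero h2)]
  have n1 := ord_ofPolyHom_nonneg h𝔓 h1
  have n2 := ord_ofPolyHom_nonneg h𝔓 h2
  have n3 := ord_ofPolyHom_nonneg h𝔓 hk0
  rcases ord_y_sub_trichotomy h𝔓 v with h | h | ⟨h, h', he⟩
  · omega
  · omega
  · obtain ⟨m, hm⟩ := he u₁ h1
    obtain ⟨m', hm'⟩ := he u₂ h2
    omega

theorem mumfordOrd_self (v : K[X]) :
    mumfordOrd 𝔓 (H.f - v ^ 2) v = 𝔓.ord (H.y - H.ofPolyHom v) := by
  rw [mumfordOrd, ← ord_y_sub_add_ord_y_sub]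
  have := ord_y_sub_nonneg h𝔓 (-v)
  omega

theorem mumfordOrd_add_neg {u v : K[X]} (h : u ∣ H.f - v ^ 2) :
    mumfordOrd 𝔓 u v + mumfordOrd 𝔓 u (-v) = 𝔓.ord (H.ofPolyHom u) := by
  obtain ⟨k, hk⟩ := h
  have h0 : u * k ≠ 0 := hk ▸ f_sub_sq_ne_zero v
  have hk0 := right_ne_zero_of_mul h0
  have h1 := left_ne_zero_of_mul h0
  have hs := ord_y_sub_add_ord_y_sub 𝔓 v
  rw [hk, map_mul, ord_mul 𝔓 (H.ofPolyHom_ne_zero h1) (H.ofPolyHom_ne_zero hk0)] at hs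
  have n1 := ord_ofPolyHom_nonneg h𝔓 h1
  have n3 := ord_ofPolyHom_nonneg h𝔓 hk0
  rw [mumfordOrd, mumfordOrd]
  rcases ord_y_sub_trichotomy h𝔓 v with h | h | ⟨h, h', he⟩
  · omega
  · omega
  · obtain ⟨m, hm⟩ := he u h1
    omega

theorem mumfordOrd_of_isUnit {u : K[X]} (hu : IsUnit u) (v : K[X]) : mumfordOrd 𝔓 u v = 0 := by
  obtain ⟨c, hc, rfl⟩ := Polynomial.isUnit_iff.1 hu
  rw [mumfordOrd, ofPolyHom_C, ord_eq_zero 𝔓 (𝔓.val_algebraMap hc.ne_zero)]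
  exact min_eq_left (ord_y_sub_nonneg h𝔓 v)

/-- Changing `v` by a multiple of `u` does not change the ideal generated by `u` and `y - v`. -/
theorem mumfordOrd_congr {u v w : K[X]} (hu : u ≠ 0) (h : u ∣ v - w) :
    mumfordOrd 𝔓 u v = mumfordOrd 𝔓 u w := by
  have key : ∀ {v w : K[X]}, u ∣ v - w →
      mumfordOrd 𝔓 u v ≤ 𝔓.ord (H.y - H.ofPolyHom w) := by
    rintro v w ⟨k, hk⟩
    obtain ⟨t, ht⟩ := exists_isUniformizer 𝔓
    have hle : 𝔓.val (H.y - H.ofPolyHom w) ≤ 𝔓.val t ^ mumfordOrd 𝔓 u v := by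
      have : H.y - H.ofPolyHom w =
          (H.y - H.ofPolyHom v) + H.ofPolyHom u * H.ofPolyHom k := by
        rw [← map_mul, ← hk, map_sub]
        ring
      rw [this]
      refine Valuation.map_add_le _ ?_ ?_
      · rw [ht.val_eq (H.y_sub_ne_zero v)]
        exact ht.strictAnti.antitone (min_le_right _ _)
      · rw [map_mul, ht.val_eq (H.ofPolyHom_ne_zero hu)]
        exact (mul_le_of_le_one_right' (val_ofPolyHom_le_one h𝔓 k)).trans
          (ht.strictAnti.antitone (min_le_left _ _))
    rw [ht.val_eq (H.y_sub_ne_zero w)] at hle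
    exact ht.strictAnti.le_iff_ge.1 hle
  have h' : u ∣ w - v := by rw [← neg_sub]; exact (dvd_neg (α := K[X])).2 h
  exact le_antisymm (le_min (min_le_left _ _) (key h)) (le_min (min_le_left _ _) (key h'))

theorem mumfordOrd_irreducible_eq_one {π v : K[X]} (hπ : Irreducible π)
    (hv : π ∣ H.f - v ^ 2) (h𝔓π : 𝔓.val (H.ofPolyHom π) < 1)
    (h𝔓v : 𝔓.val (H.y - H.ofPolyHom v) < 1) : mumfordOrd 𝔓 π v = 1 := by
  have h1 := (ord_pos_iff 𝔓 (H.ofPolyHom_ne_zero hπ.ne_zero)).2 h𝔓π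
  have h2 := (ord_pos_iff 𝔓 (H.y_sub_ne_zero v)).2 h𝔓v
  have ht := isUniformizer_localParam h𝔓 hπ h𝔓π
  rw [mumfordOrd]
  by_cases hf : π ∣ H.f
  · have hy := (val_y_lt_one_iff h𝔓 hπ h𝔓π).2 hf
    have hπv : π ∣ v := hπ.prime.dvd_of_dvd_pow (n := 2) ((dvd_sub_right hf).1 hv)
    have h3 := ord_y_sub_of_ramified h𝔓 hy ((val_ofPolyHom_lt_one_iff h𝔓 hπ h𝔓π v).2 hπv)
    omega
  · rw [localParam, if_neg hf] at ht
    have := ht.ord_self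
    omega

theorem mumfordOrd_eq_zero {u v : K[X]} (hu : u ≠ 0)
    (h : ¬ (𝔓.val (H.ofPolyHom u) < 1 ∧ 𝔓.val (H.y - H.ofPolyHom v) < 1)) :
    mumfordOrd 𝔓 u v = 0 := by
  rw [← ord_pos_iff 𝔓 (H.ofPolyHom_ne_zero hu), ← ord_pos_iff 𝔓 (H.y_sub_ne_zero v)] at h
  have h1 := ord_ofPolyHom_nonneg h𝔓 hu
  have h2 := ord_y_sub_nonneg h𝔓 v
  rw [mumfordOrd]
  omega

end Mumford

end GenusTwoCurve

/-! ### Orders under automorphisms of the field. -/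

namespace FunField.Place

variable {K F : Type*} [Field K] [Field F] [Algebra K F]

theorem isEquiv_val_comap (σ : F ≃ₐ[K] F) (𝔓 : Place K F) :
    (comap σ 𝔓).val.IsEquiv (𝔓.val.comap (σ : F →+* F)) :=
  Valuation.isEquiv_of_val_le_one fun {z} => by
    rw [val_le_one_iff, Valuation.comap_apply]
    exact (𝔓.val_le_one_iff (z := σ z)).symm

theorem ord_comap (σ : F ≃ₐ[K] F) {𝔓 : Place K F} {t : F} (ht : 𝔓.IsUniformizer t) {z : F}
    (hz : z ≠ 0) : (comap σ 𝔓).ord z = 𝔓.ord (σ z) := by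
  have he := isEquiv_val_comap σ 𝔓
  have heq (a b : F) : (comap σ 𝔓).val a = (comap σ 𝔓).val b ↔ 𝔓.val (σ a) = 𝔓.val (σ b) :=
    he.eq_iff
  have ht' : (comap σ 𝔓).IsUniformizer (σ.symm t) := by
    refine ⟨by simpa using ht.ne_zero, ?_, fun w hw => ?_⟩
    · have := he.lt_one_iff_lt_one (x := σ.symm t)
      rw [this]
      change 𝔓.val (σ (σ.symm t)) < 1
      rw [AlgEquiv.apply_symm_apply]
      exact ht.val_lt_one
    · obtain ⟨n, hn⟩ := ht.exists_eq_zpow (σ w) (by simpa using hw)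
      refine ⟨n, ?_⟩
      rw [← map_zpow₀, heq, map_zpow₀, AlgEquiv.apply_symm_apply, hn, map_zpow₀]
  refine ht'.ord_eq_of_val_eq ?_
  rw [← map_zpow₀, heq, map_zpow₀, AlgEquiv.apply_symm_apply,
    ht.val_eq (by simpa using hz : σ z ≠ 0), map_zpow₀]

theorem comap_comap_of_involutive {σ : F ≃ₐ[K] F} (hσ : Function.Involutive σ) (𝔓 : Place K F) :
    comap σ (comap σ 𝔓) = 𝔓 :=
  Place.ext <| ValuationSubring.ext _ _ fun z => by
    change σ (σ z) ∈ 𝔓.ring ↔ _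
    rw [hσ]

end FunField.Place

namespace GenusTwoCurve

variable {K : Type*} [Field K] {H : GenusTwoCurve K}

/-! ### Divisors given by a pair of polynomials -/

/-- The divisor `D` is given by the pair `⟨u, v⟩`, where `u` may have any degree. -/
structure IsPairDivisor (u v : K[X]) (D : Divisor K H.FunctionField) : Prop where
  finite : ∀ 𝔓, ¬ H.IsInfinity 𝔓 → D 𝔓 = mumfordOrd 𝔓 u v
  infinite : ∀ 𝔓, H.IsInfinity 𝔓 → D 𝔓 = -(u.natDegree : ℤ)

namespace IsPairDivisor

variable {u u₁ u₂ v w : K[X]} {D D₁ D₂ : Divisor K H.FunctionField}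

theorem unique (h₁ : IsPairDivisor u v D₁) (h₂ : IsPairDivisor u v D₂) : D₁ = D₂ := by
  ext 𝔓
  by_cases h : H.IsInfinity 𝔓
  · rw [h₁.infinite 𝔓 h, h₂.infinite 𝔓 h]
  · rw [h₁.finite 𝔓 h, h₂.finite 𝔓 h]

theorem add (h₁ : IsPairDivisor u₁ v D₁) (h₂ : IsPairDivisor u₂ v D₂)
    (h : u₁ * u₂ ∣ H.f - v ^ 2) : IsPairDivisor (u₁ * u₂) v (D₁ + D₂) where
  finite 𝔓 h𝔓 := by
    rw [mumfordOrd_mul h𝔓 h, Finsupp.add_apply, h₁.finite 𝔓 h𝔓, h₂.finite 𝔓 h𝔓]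
  infinite 𝔓 h𝔓 := by
    have h0 : u₁ * u₂ ≠ 0 := fun h0 => f_sub_sq_ne_zero v (zero_dvd_iff.1 (h0 ▸ h))
    rw [natDegree_mul (left_ne_zero_of_mul h0) (right_ne_zero_of_mul h0), Finsupp.add_apply,
      h₁.infinite 𝔓 h𝔓, h₂.infinite 𝔓 h𝔓]
    push_cast
    ring

theorem of_isUnit (hu : IsUnit u) : IsPairDivisor u v (0 : Divisor K H.FunctionField) where
  finite 𝔓 h𝔓 := by rw [mumfordOrd_of_isUnit h𝔓 hu, Finsupp.zero_apply]
  infinite 𝔓 h𝔓 := by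
    rw [natDegree_eq_zero_of_isUnit hu, Finsupp.zero_apply, Nat.cast_zero, neg_zero]

theorem congr (h : IsPairDivisor u v D) (hu : u ≠ 0) (hvw : u ∣ v - w) :
    IsPairDivisor u w D where
  finite 𝔓 h𝔓 := by rw [← mumfordOrd_congr h𝔓 hu hvw, h.finite 𝔓 h𝔓]
  infinite := h.infinite

theorem isMumford (h : IsPairDivisor u v D) (hu : u.Monic) (hd : u.natDegree ≤ 2)
    (hv : v.degree < u.degree) (hdvd : u ∣ H.f - v ^ 2) : H.IsMumford u v D where
  monic := hu
  natDegree_le := hd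
  degree_lt := hv
  dvd := hdvd
  finite 𝔓 h𝔓 := ⟨_, _, (hasOrd_iff_ord 𝔓 (H.ofPolyHom_ne_zero hu.ne_zero)).2 rfl,
    (hasOrd_iff_ord 𝔓 (H.y_sub_ne_zero v)).2 rfl, h.finite 𝔓 h𝔓⟩
  infinite := h.infinite

end IsPairDivisor

theorem IsMumford.isPairDivisor {u v : K[X]} {D : Divisor K H.FunctionField}
    (h : H.IsMumford u v D) : IsPairDivisor u v D where
  finite 𝔓 h𝔓 := by
    obtain ⟨m, n, hm, hn, hD⟩ := h.finite 𝔓 h𝔓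
    have hm' := (hasOrd_iff_ord 𝔓 (H.ofPolyHom_ne_zero h.monic.ne_zero)).1 hm
    have hn' := (hasOrd_iff_ord 𝔓 (H.y_sub_ne_zero v)).1 hn
    rw [hD, ← hm', ← hn', mumfordOrd]
  infinite := h.infinite

theorem single_sub_single_apply {𝔓 inf : Place K H.FunctionField} (h𝔓 : ¬ H.IsInfinity 𝔓)
    (hinf : H.IsInfinity inf) (n : ℕ) :
    (∀ 𝔔, ¬ H.IsInfinity 𝔔 → 𝔔 ≠ 𝔓 →
      (Finsupp.single 𝔓 (1 : ℤ) - n • Finsupp.single inf (1 : ℤ) :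
        Divisor K H.FunctionField) 𝔔 = 0) ∧
    (Finsupp.single 𝔓 (1 : ℤ) - n • Finsupp.single inf (1 : ℤ) :
        Divisor K H.FunctionField) 𝔓 = 1 ∧
    (∀ 𝔔, H.IsInfinity 𝔔 →
      (Finsupp.single 𝔓 (1 : ℤ) - n • Finsupp.single inf (1 : ℤ) :
        Divisor K H.FunctionField) 𝔔 = -n) := by
  have h1 : ∀ 𝔔, ¬ H.IsInfinity 𝔔 → inf ≠ 𝔔 := by
    rintro 𝔔 h rfl
    exact h hinf
  refine ⟨fun 𝔔 h h' => ?_, ?_, fun 𝔔 h => ?_⟩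
  · rw [Finsupp.sub_apply, Finsupp.smul_apply, Finsupp.single_eq_of_ne h',
      Finsupp.single_eq_of_ne (h1 𝔔 h).symm]
    simp
  · rw [Finsupp.sub_apply, Finsupp.smul_apply, Finsupp.single_eq_same,
      Finsupp.single_eq_of_ne (h1 𝔓 h𝔓).symm]
    simp
  · have h2 : 𝔔 ≠ 𝔓 := by
      rintro rfl
      exact h𝔓 h
    obtain rfl := infinity_unique h hinf
    rw [Finsupp.sub_apply, Finsupp.smul_apply, Finsupp.single_eq_same,
      Finsupp.single_eq_of_ne h2]
    simp

/-- By `place_unique`, `𝔓` is the only finite place at which `π` and `y - v` both vanish, and the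
multiplicity there is one. -/
theorem isPairDivisor_place {π v : K[X]} (hπ : Irreducible π) (hv : π ∣ H.f - v ^ 2)
    {𝔓 inf : Place K H.FunctionField} (h𝔓 : ¬ H.IsInfinity 𝔓)
    (h𝔓π : 𝔓.val (H.ofPolyHom π) < 1) (h𝔓v : 𝔓.val (H.y - H.ofPolyHom v) < 1)
    (hinf : H.IsInfinity inf) :
    IsPairDivisor π v (Finsupp.single 𝔓 1 - π.natDegree • Finsupp.single inf 1) := by
  obtain ⟨h1, h2, h3⟩ := single_sub_single_apply h𝔓 hinf π.natDegree
  refine ⟨fun 𝔔 h𝔔 => ?_, h3⟩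
  by_cases h : 𝔔.val (H.ofPolyHom π) < 1 ∧ 𝔔.val (H.y - H.ofPolyHom v) < 1
  · obtain rfl := place_unique h𝔓 hπ h𝔓π h𝔓v h𝔔 h.1 h.2
    rw [h2, mumfordOrd_irreducible_eq_one h𝔓 hπ hv h𝔓π h𝔓v]
  · rw [mumfordOrd_eq_zero h𝔔 hπ.ne_zero h]
    refine h1 𝔔 h𝔔 ?_
    rintro rfl
    exact h ⟨h𝔓π, h𝔓v⟩

theorem single_sub_single_mem_degreeZero {π v : K[X]} (hπ : Irreducible π)
    {𝔓 inf : Place K H.FunctionField} (h𝔓 : ¬ H.IsInfinity 𝔓)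
    (h𝔓π : 𝔓.val (H.ofPolyHom π) < 1) (h𝔓v : 𝔓.val (H.y - H.ofPolyHom v) < 1)
    (hinf : H.IsInfinity inf) :
    Finsupp.single 𝔓 1 - π.natDegree • Finsupp.single inf 1 ∈
      Divisor.degreeZero K H.FunctionField := by
  rw [Divisor.degreeZero, AddMonoidHom.mem_ker, map_sub, map_nsmul]
  simp only [Divisor.degree, Finsupp.liftAddHom_apply_single, AddMonoidHom.coe_mulRight,
    degree_infinity hinf, degree_place h𝔓 hπ h𝔓π h𝔓v]
  simp

/-- The pair `⟨u, v⟩` defines a divisor of degree zero. -/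
theorem exists_isPairDivisor {inf : Place K H.FunctionField} (hinf : H.IsInfinity inf)
    {u v : K[X]} (h : u ∣ H.f - v ^ 2) :
    ∃ G ∈ Divisor.degreeZero K H.FunctionField, IsPairDivisor u v G := by
  have h0 : u ≠ 0 := fun h0 => f_sub_sq_ne_zero v (zero_dvd_iff.1 (h0 ▸ h))
  -- Each prime factor `π` contributes the place over `(π, y - v)` minus `deg π` times infinity;
  -- this has degree zero because the place has degree `deg π`.
  induction u using UniqueFactorizationMonoid.induction_on_prime with
  | h₁ => exact absurd rfl h0
  | h₂ u hu => exact ⟨0, zero_mem _, .of_isUnit hu⟩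
  | h₃ u π hu hπ ih =>
    obtain ⟨G, hG, hG'⟩ := ih (dvd_of_mul_left_dvd h) hu
    have hv := dvd_of_mul_right_dvd h
    obtain ⟨𝔓, h𝔓, h𝔓π, h𝔓v⟩ := exists_place hπ.irreducible hv
    exact ⟨_, add_mem (single_sub_single_mem_degreeZero hπ.irreducible h𝔓 h𝔓π h𝔓v hinf) hG,
      (isPairDivisor_place hπ.irreducible hv h𝔓 h𝔓π h𝔓v hinf).add hG' h⟩

theorem IsPairDivisor.mem_degreeZero {inf : Place K H.FunctionField} (hinf : H.IsInfinity inf)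
    {u v : K[X]} {D : Divisor K H.FunctionField} (hD : IsPairDivisor u v D)
    (h : u ∣ H.f - v ^ 2) : D ∈ Divisor.degreeZero K H.FunctionField := by
  obtain ⟨G, hG, hG'⟩ := exists_isPairDivisor hinf h
  rwa [hD.unique hG']

/-! ### Principal divisors -/

/-- The orders of `y` and `v` have different parity, so there is no cancellation and the sign of `v`
is immaterial. -/
theorem ord_y_sub_neg_of_isInfinity {𝔓 : Place K H.FunctionField} (h𝔓 : H.IsInfinity 𝔓)
    (v : K[X]) : 𝔓.ord (H.y - H.ofPolyHom (-v)) = 𝔓.ord (H.y - H.ofPolyHom v) := by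
  by_cases hv : v = 0
  · rw [hv, neg_zero]
  have hv0 := H.ofPolyHom_ne_zero hv
  have h1 := ord_y_of_isInfinity h𝔓
  have h2 := ord_ofPolyHom_of_isInfinity h𝔓 hv
  rw [map_neg, sub_neg_eq_add, sub_eq_add_neg]
  rcases lt_or_gt_of_ne (show 𝔓.ord H.y ≠ 𝔓.ord (H.ofPolyHom v) by omega) with h | h
  · rw [ord_add 𝔓 H.y_ne_zero hv0 h,
      ord_add 𝔓 H.y_ne_zero (neg_ne_zero.2 hv0) (by rwa [ord_neg])]
  · rw [add_comm, ord_add 𝔓 hv0 H.y_ne_zero h, add_comm,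
      ord_add 𝔓 (neg_ne_zero.2 hv0) H.y_ne_zero (by rwa [ord_neg]), ord_neg]

/-- It is the divisor of `y - v`. At infinity, `y - v` and `y + v` share equally the order `-2 deg
(f - v²)` of their product. -/
theorem IsPairDivisor.mem_principal {v : K[X]} {D : Divisor K H.FunctionField}
    (hD : IsPairDivisor (H.f - v ^ 2) v D) : D ∈ Divisor.principal K H.FunctionField := by
  refine Or.inr ⟨_, H.y_sub_ne_zero v, fun 𝔓 => (hasOrd_iff_ord 𝔓 (H.y_sub_ne_zero v)).2 ?_⟩
  by_cases h : H.IsInfinity 𝔓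
  · have h1 := ord_y_sub_add_ord_y_sub 𝔓 v
    rw [ord_y_sub_neg_of_isInfinity h, ord_ofPolyHom_of_isInfinity h (f_sub_sq_ne_zero v)] at h1
    rw [hD.infinite 𝔓 h]
    omega
  · rw [hD.finite 𝔓 h, mumfordOrd_self h]

theorem IsPairDivisor.add_neg_mem_principal {u v : K[X]} {D D' : Divisor K H.FunctionField}
    (hD : IsPairDivisor u v D) (hD' : IsPairDivisor u (-v) D') (h : u ∣ H.f - v ^ 2) :
    D + D' ∈ Divisor.principal K H.FunctionField := by
  have h0 : u ≠ 0 := fun h0 => f_sub_sq_ne_zero v (zero_dvd_iff.1 (h0 ▸ h))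
  have h1 := H.ofPolyHom_ne_zero h0
  refine Or.inr ⟨_, h1, fun 𝔓 => (hasOrd_iff_ord 𝔓 h1).2 ?_⟩
  rw [Finsupp.add_apply]
  by_cases h' : H.IsInfinity 𝔓
  · rw [hD.infinite 𝔓 h', hD'.infinite 𝔓 h', ord_ofPolyHom_of_isInfinity h' h0]
    ring
  · rw [hD.finite 𝔓 h', hD'.finite 𝔓 h', mumfordOrd_add_neg h' h]

/-! ### The involution -/

theorem involution_ofPolyHom (g : K[X]) : H.involution (H.ofPolyHom g) = H.ofPolyHom g := by
  have h : H.negEquiv (AdjoinRoot.of H.polynomial g) = AdjoinRoot.of H.polynomial g :=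
    AdjoinRoot.lift_of H.eval₂_neg_root
  have h2 := IsFractionRing.fieldEquivOfAlgEquiv_algebraMap K H.FunctionField H.FunctionField
    H.negEquiv (AdjoinRoot.of H.polynomial g)
  rw [h] at h2
  exact h2

theorem involution_y : H.involution H.y = -H.y := by
  have h : H.negEquiv (AdjoinRoot.root H.polynomial) = -AdjoinRoot.root H.polynomial :=
    AdjoinRoot.lift_root H.eval₂_neg_root
  have h2 := IsFractionRing.fieldEquivOfAlgEquiv_algebraMap K H.FunctionField H.FunctionField
    H.negEquiv (AdjoinRoot.root H.polynomial)
  rw [h, map_neg] at h2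
  exact h2

theorem involution_involutive : Function.Involutive H.involution := by
  intro z
  obtain ⟨a, b, c, -, rfl⟩ := H.exists_repr z
  simp only [map_div₀, map_add, map_mul, map_neg, involution_ofPolyHom, involution_y, neg_neg]

theorem isInfinity_comap_involution {𝔓 : Place K H.FunctionField} :
    H.IsInfinity (Place.comap H.involution 𝔓) ↔ H.IsInfinity 𝔓 := by
  have h : H.involution H.x = H.x := involution_ofPolyHom X
  change ¬ (H.involution H.x ∈ 𝔓.ring) ↔ _
  rw [h]
  rfl

theorem mumfordOrd_comap_involution (𝔓 : Place K H.FunctionField) {u : K[X]} (hu : u ≠ 0)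
    (v : K[X]) : mumfordOrd (Place.comap H.involution 𝔓) u v = mumfordOrd 𝔓 u (-v) := by
  obtain ⟨t, ht⟩ := exists_isUniformizer 𝔓
  rw [mumfordOrd, mumfordOrd, Place.ord_comap _ ht (H.ofPolyHom_ne_zero hu),
    Place.ord_comap _ ht (H.y_sub_ne_zero v), map_sub, involution_ofPolyHom, involution_ofPolyHom,
    involution_y, ← ord_neg 𝔓 (-H.y - H.ofPolyHom v), map_neg, neg_sub, sub_neg_eq_add,
    sub_neg_eq_add, add_comm]

theorem involutionDivisor_apply (D : Divisor K H.FunctionField) (𝔓 : Place K H.FunctionField) :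
    H.involutionDivisor D 𝔓 = D (Place.comap H.involution 𝔓) := by
  have hinv := Place.comap_comap_of_involutive (H.involution_involutive)
  have h := Finsupp.mapDomain_apply (f := Place.comap H.involution)
    (Function.LeftInverse.injective hinv) D (Place.comap H.involution 𝔓)
  rwa [hinv] at h

theorem IsPairDivisor.involution {u v : K[X]} {D : Divisor K H.FunctionField}
    (hD : IsPairDivisor u v D) (hu : u ≠ 0) : IsPairDivisor u (-v) (H.involutionDivisor D) where
  finite 𝔓 h𝔓 := by
    rw [involutionDivisor_apply, hD.finite _ (isInfinity_comap_involution.not.2 h𝔓),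
      mumfordOrd_comap_involution 𝔓 hu]
  infinite 𝔓 h𝔓 := by
    rw [involutionDivisor_apply, hD.infinite _ (isInfinity_comap_involution.2 h𝔓)]

/-! ### Rational points -/

section Point

variable {𝔓 : Place K H.FunctionField} {a b : K} (h : H.IsPoint 𝔓 a b)
include h

theorem IsPoint.val_X_sub_C_lt_one : 𝔓.val (H.ofPolyHom (X - C a)) < 1 := by
  rw [map_sub, ofPolyHom_X, ofPolyHom_C]
  exact 𝔓.isZero_iff.1 h.1

theorem IsPoint.not_isInfinity : ¬ H.IsInfinity 𝔓 := by
  rw [IsInfinity, not_not]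
  have h1 := 𝔓.val_le_one_iff.1 h.val_X_sub_C_lt_one.le
  have h2 : algebraMap K H.FunctionField a ∈ 𝔓.ring := 𝔓.base_lt.le ⟨a, rfl⟩
  rw [map_sub, ofPolyHom_X, ofPolyHom_C] at h1
  simpa using add_mem h1 h2

theorem IsPoint.val_ofPolyHom_lt_one_iff (g : K[X]) :
    𝔓.val (H.ofPolyHom g) < 1 ↔ g.eval a = 0 := by
  rw [GenusTwoCurve.val_ofPolyHom_lt_one_iff h.not_isInfinity (irreducible_X_sub_C a)
    h.val_X_sub_C_lt_one, dvd_iff_isRoot, IsRoot.def]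

theorem IsPoint.val_y_sub_lt_one_iff (v : K[X]) :
    𝔓.val (H.y - H.ofPolyHom v) < 1 ↔ v.eval a = b := by
  have h1 := 𝔓.isZero_iff.1 h.2
  have h2 := h.val_ofPolyHom_lt_one_iff (v - C b)
  rw [eval_sub, eval_C, sub_eq_zero] at h2
  rw [← h2, map_sub H.ofPolyHom, ofPolyHom_C]
  constructor
  · intro h3
    have := Valuation.map_sub_lt _ h1 h3
    rwa [sub_sub_sub_cancel_left] at this
  · intro h3
    have := Valuation.map_sub_lt _ h1 h3
    rwa [sub_sub_sub_cancel_right] at this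

theorem IsPoint.eval_f : H.f.eval a = b ^ 2 := by
  have h1 := (h.val_y_sub_lt_one_iff (C b)).2 eval_C
  have h2 : 𝔓.val (H.ofPolyHom (H.f - C b ^ 2)) < 1 := by
    rw [← y_sub_mul_y_sub, mul_comm]
    exact 𝔓.val_mul_lt_one (Valuation.map_sub_le _ (val_y_le_one h.not_isInfinity)
      (val_ofPolyHom_le_one h.not_isInfinity _)) h1
  rw [h.val_ofPolyHom_lt_one_iff, eval_sub, eval_pow, eval_C, sub_eq_zero] at h2
  exact h2

theorem IsPoint.X_sub_C_dvd {v : K[X]} (hv : v.eval a = b) : X - C a ∣ H.f - v ^ 2 := by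
  rw [dvd_iff_isRoot, IsRoot.def, eval_sub, eval_pow, h.eval_f, hv, sub_self]

theorem IsPoint.isPairDivisor {v : K[X]} (hv : v.eval a = b) {inf : Place K H.FunctionField}
    (hinf : H.IsInfinity inf) :
    IsPairDivisor (X - C a) v (Finsupp.single 𝔓 1 - Finsupp.single inf 1) := by
  have := isPairDivisor_place (irreducible_X_sub_C a) (h.X_sub_C_dvd hv) h.not_isInfinity
    h.val_X_sub_C_lt_one ((h.val_y_sub_lt_one_iff v).2 hv) hinf
  rwa [natDegree_X_sub_C, one_smul] at this

theorem IsPoint.mem_degreeZero {inf : Place K H.FunctionField} (hinf : H.IsInfinity inf) :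
    Finsupp.single 𝔓 1 - Finsupp.single inf 1 ∈ Divisor.degreeZero K H.FunctionField :=
  (h.isPairDivisor (v := C b) eval_C hinf).mem_degreeZero hinf (h.X_sub_C_dvd eval_C)

theorem IsPoint.eval_of_mumfordOrd_pos {u v : K[X]} (hu : u ≠ 0) (hpos : 0 < mumfordOrd 𝔓 u v) :
    u.eval a = 0 ∧ v.eval a = b := by
  rw [← h.val_ofPolyHom_lt_one_iff, ← h.val_y_sub_lt_one_iff]
  by_contra hn
  rw [mumfordOrd_eq_zero h.not_isInfinity hu hn] at hpos
  exact lt_irrefl _ hpos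

theorem IsPoint.unique {𝔔 : Place K H.FunctionField} (h' : H.IsPoint 𝔔 a b) : 𝔓 = 𝔔 :=
  place_unique h.not_isInfinity (irreducible_X_sub_C a) h.val_X_sub_C_lt_one
    ((h.val_y_sub_lt_one_iff (C b)).2 eval_C) h'.not_isInfinity h'.val_X_sub_C_lt_one
    ((h'.val_y_sub_lt_one_iff (C b)).2 eval_C)

end Point

/-- Positive multiplicity of a point forces `u` to vanish at its abscissa and `v` to take its
ordinate as value. For distinct abscissas this gives both roots of `u`; for equal ones the
multiplicity two shows that the root is double. -/
theorem IsMumford.roots {𝔭 𝔪 inf : Place K H.FunctionField} {s t μx μy : K}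
    (h𝔭 : H.IsPoint 𝔭 s t) (h𝔪 : H.IsPoint 𝔪 μx μy) (hinf : H.IsInfinity inf)
    {a b : K} {v : K[X]} (h : H.IsMumford (X ^ 2 + C a * X + C b) v
      (Finsupp.single 𝔭 1 + Finsupp.single 𝔪 1 - 2 • Finsupp.single inf 1)) :
    a = -(s + μx) ∧ b = s * μx ∧ v.eval s = t ∧ v.eval μx = μy := by
  have hp := h.isPairDivisor
  have hu := h.monic.ne_zero
  have hD : ∀ 𝔔, ¬ H.IsInfinity 𝔔 → Finsupp.single 𝔭 (1 : ℤ) 𝔔 + Finsupp.single 𝔪 (1 : ℤ) 𝔔 =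
      mumfordOrd 𝔔 (X ^ 2 + C a * X + C b) v := by
    intro 𝔔 h𝔔
    rw [← hp.finite 𝔔 h𝔔, Finsupp.sub_apply, Finsupp.add_apply, Finsupp.smul_apply,
      Finsupp.single_eq_of_ne (a := inf) (a' := 𝔔) (by rintro rfl; exact h𝔔 hinf)]
    simp
  have hnn (𝔔 𝔔' : Place K H.FunctionField) : 0 ≤ Finsupp.single 𝔔 (1 : ℤ) 𝔔' := by
    classical
    rw [Finsupp.single_apply]
    split_ifs <;> norm_num
  have h1 := h𝔭.eval_of_mumfordOrd_pos hu (v := v) (by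
    rw [← hD 𝔭 h𝔭.not_isInfinity, Finsupp.single_eq_same]
    linarith [hnn 𝔪 𝔭])
  have h2 := h𝔪.eval_of_mumfordOrd_pos hu (v := v) (by
    rw [← hD 𝔪 h𝔪.not_isInfinity, Finsupp.single_eq_same]
    linarith [hnn 𝔭 𝔪])
  simp only [eval_add, eval_mul, eval_pow, eval_X, eval_C] at h1 h2
  obtain ⟨h1, h1'⟩ := h1
  obtain ⟨h2, h2'⟩ := h2
  suffices ha : a = -(s + μx) from
    ⟨ha, by rw [ha] at h1; linear_combination h1, h1', h2'⟩
  by_cases hs : s = μx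
  · subst hs
    have ht : t = μy := h1'.symm.trans h2'
    subst ht
    obtain rfl := h𝔭.unique h𝔪
    have hD1 := hD 𝔭 h𝔭.not_isInfinity
    have hfac : X ^ 2 + C a * X + C b = (X - C s) * (X - C (-a - s)) := by
      have hb : b = -s ^ 2 - a * s := by linear_combination h1
      rw [hb]
      simp only [map_sub, map_neg, map_mul, map_pow]
      ring
    have hdvd := h.dvd
    rw [hfac] at hD1 hdvd
    -- The factor `X - s` accounts for only one of the two units of multiplicity, so the other
    -- linear factor also vanishes at `s`.
    rw [mumfordOrd_mul h𝔭.not_isInfinity hdvd, mumfordOrd_irreducible_eq_one h𝔭.not_isInfinity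
      (irreducible_X_sub_C s) (h𝔭.X_sub_C_dvd h1') h𝔭.val_X_sub_C_lt_one
      ((h𝔭.val_y_sub_lt_one_iff v).2 h1'), Finsupp.single_eq_same] at hD1
    have h3 := (h𝔭.eval_of_mumfordOrd_pos (X_sub_C_ne_zero (-a - s)) (v := v) (by omega)).1
    rw [eval_sub, eval_X, eval_C] at h3
    linear_combination h3
  · have : (s - μx) * (a + (s + μx)) = 0 := by linear_combination h1 - h2
    have := (mul_eq_zero.1 this).resolve_left (sub_ne_zero.2 hs)
    linear_combination this

end GenusTwoCurve

/-! ### Linear algebra and degrees for the interpolating cubic. -/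

namespace GenusTwoCurve

variable {K : Type*} [Field K]

/-- Evaluating either remainder at the common root `s` gives the value of the cubic there: `s` times
the first row plus the second equals `s` times the third plus the fourth, namely `(s³, s², s, 1)`.
-/
theorem det_interpolationMatrix (s p q : K) :
    (interpolationMatrix (-(s + p)) (s * p) (-(s + q)) (s * q)).det = 0 := by
  simp [interpolationMatrix, Matrix.det_succ_row_zero, Fin.sum_univ_succ, Fin.succAbove]
  ring

/-- This is the resultant of `(X - s)²` and `(X - p)(X - q)`. -/
theorem det_sharedMatrix (s p q : K) :
    (sharedMatrix s p q).det = (s - p) ^ 2 * (s - q) ^ 2 := by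
  simp [sharedMatrix, Matrix.det_succ_row_zero, Fin.sum_univ_succ, Fin.succAbove]
  ring

theorem existsUnique_mulVec_eq {n : Type*} [Fintype n] [DecidableEq n] {A : Matrix n n K}
    (hA : A.det ≠ 0) (b : n → K) : ∃! c, A.mulVec c = b := by
  have hA' : IsUnit A.det := isUnit_iff_ne_zero.2 hA
  refine ⟨A⁻¹.mulVec b, ?_, fun c hc => ?_⟩
  · simp only [Matrix.mulVec_mulVec, Matrix.mul_nonsing_inv _ hA', Matrix.one_mulVec]
  · rw [← hc, Matrix.mulVec_mulVec, Matrix.nonsing_inv_mul _ hA', Matrix.one_mulVec]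

theorem sq_X_sub_C_dvd {g : K[X]} {s : K} (h : g.eval s = 0) (h' : g.derivative.eval s = 0) :
    (X - C s) * (X - C s) ∣ g := by
  obtain ⟨k, rfl⟩ := dvd_iff_isRoot.2 h
  refine mul_dvd_mul_left _ (dvd_iff_isRoot.2 ?_)
  simpa using h'

theorem dvd_sub_of_mulVec_eq {s t m μx μy ωx ωy P Q R S : K}
    (h : (sharedMatrix s μx ωx).mulVec ![P, Q, R, S] = sharedVector m s t μx μy ωx ωy) :
    (X - C s) * (X - C s) ∣ (C P * X ^ 3 + C Q * X ^ 2 + C R * X + C S) -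
      (C m * X + C (t - m * s)) ∧
    (X - C μx) * (X - C ωx) ∣ (C P * X ^ 3 + C Q * X ^ 2 + C R * X + C S) -
      (C ((μy - ωy) / (μx - ωx)) * X + C ((μx * ωy - ωx * μy) / (μx - ωx))) := by
  have h0 := congrFun h 0
  have h1 := congrFun h 1
  have h2 := congrFun h 2
  have h3 := congrFun h 3
  simp only [sharedMatrix, sharedVector, Matrix.mulVec, dotProduct, Fin.sum_univ_four,
    Matrix.of_apply, Matrix.cons_val', Matrix.cons_val_zero, Matrix.cons_val_one,
    Matrix.cons_val, Matrix.cons_val_fin_one] at h0 h1 h2 h3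
  constructor
  -- The quotient in the division of the cubic by `(X - s)²`; the first two equations give the
  -- remainder.
  · refine ⟨C P * X + C (Q + 2 * s * P), ?_⟩
    rw [← h1, ← h0]
    simp only [map_add, map_mul, map_pow, map_neg, map_ofNat, map_one, map_zero]
    ring
  · refine ⟨C P * X + C (Q + (μx + ωx) * P), ?_⟩
    rw [← h2, ← h3]
    simp only [map_add, map_mul, map_pow, map_neg, map_sub, map_one, map_zero]
    ring

theorem natDegree_sq_sub {f : K[X]} (hf : f.natDegree = 5) {P : K} (hP : P ≠ 0) (Q R S : K) :
    ((C P * X ^ 3 + C Q * X ^ 2 + C R * X + C S) ^ 2 - f).natDegree = 6 ∧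
    ((C P * X ^ 3 + C Q * X ^ 2 + C R * X + C S) ^ 2 - f).leadingCoeff = P ^ 2 := by
  set L := C P * X ^ 3 + C Q * X ^ 2 + C R * X + C S with hL
  have h1 : L.natDegree = 3 := natDegree_cubic hP
  have h2 : L.leadingCoeff = P := leadingCoeff_cubic hP
  have h3 : (L ^ 2).natDegree = 6 := by rw [natDegree_pow, h1]
  have h4 : f.natDegree < (L ^ 2).natDegree := by omega
  constructor
  · rw [natDegree_sub_eq_left_of_natDegree_lt h4, h3]
  · rw [leadingCoeff_sub_of_degree_lt (degree_lt_degree h4), leadingCoeff_pow, h2]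

theorem natDegree_sq_sub' {f : K[X]} (hf : f.natDegree = 5) (Q R S : K) :
    ((C 0 * X ^ 3 + C Q * X ^ 2 + C R * X + C S) ^ 2 - f).natDegree = 5 ∧
    ((C 0 * X ^ 3 + C Q * X ^ 2 + C R * X + C S) ^ 2 - f).leadingCoeff = -f.leadingCoeff := by
  rw [map_zero, zero_mul, zero_add]
  set L := C Q * X ^ 2 + C R * X + C S with hL
  have h1 : L.natDegree ≤ 2 := natDegree_quadratic_le
  have h3 : (L ^ 2).natDegree ≤ 4 := by
    rw [natDegree_pow]
    omega
  have h4 : (L ^ 2).natDegree < f.natDegree := by omega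
  constructor
  · rw [natDegree_sub_eq_right_of_natDegree_lt h4, hf]
  · rw [leadingCoeff_sub_of_degree_lt' (degree_lt_degree h4)]

end GenusTwoCurve

/-! ### Classes in the Jacobian. -/

namespace FunField.Divisor

variable {K F : Type*} [Field K] [Field F] [Algebra K F]

theorem cls_add {D E : Divisor K F} (hD : D ∈ degreeZero K F) (hE : E ∈ degreeZero K F) :
    D.cls hD + E.cls hE = (D + E).cls (add_mem hD hE) := rfl

theorem cls_eq_neg_of_add_mem_principal {D E : Divisor K F} (hD : D ∈ degreeZero K F)
    (hE : E ∈ degreeZero K F) (h : D + E ∈ principal K F) : D.cls hD = -E.cls hE := by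
  rw [eq_neg_iff_add_eq_zero, cls_add]
  exact (QuotientAddGroup.eq_zero_iff _).2 h

end FunField.Divisor

/-! ### Proof of the theorem. -/

open GenusTwoCurve

theorem mainTheorem1 {K : Type*} [Field K] (H : GenusTwoCurve K)
    (𝔭 𝔪 𝔴 inf : Place K H.FunctionField) (s t μx μy ωx ωy : K)
    (h𝔭 : H.IsPoint 𝔭 s t) (h𝔪 : H.IsPoint 𝔪 μx μy) (h𝔴 : H.IsPoint 𝔴 ωx ωy)
    (hinf : H.IsInfinity inf)
    (D₁ D₂ E₁ E₂ : Divisor K H.FunctionField)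
    (hD₁ : D₁ = Finsupp.single 𝔭 1 + Finsupp.single 𝔪 1 - 2 • Finsupp.single inf 1)
    (hD₂ : D₂ = Finsupp.single 𝔭 1 + Finsupp.single 𝔴 1 - 2 • Finsupp.single inf 1)
    (hE₁ : E₁ = 2 • Finsupp.single 𝔭 1 - 2 • Finsupp.single inf 1)
    (hE₂ : E₂ = Finsupp.single 𝔪 1 + Finsupp.single 𝔴 1 - 2 • Finsupp.single inf 1) :
    -- the shared place is detected by, and read off from, the Mumford pairs of `D₁` and `D₂`
    (∀ (a b α β : K) (v₁ v₂ : K[X]),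
      H.IsMumford (X ^ 2 + C a * X + C b) v₁ D₁ → H.IsMumford (X ^ 2 + C α * X + C β) v₂ D₂ →
        (interpolationMatrix a b α β).det = 0 ∧
        (μx ≠ ωx → a ≠ α ∧ s = (β - b) / (a - α) ∧ t = v₁.eval s ∧
          μx = -a - s ∧ μy = v₁.eval μx ∧ ωx = -α - s ∧ ωy = v₂.eval ωx)) ∧
    -- the sum of the classes
    ∃ (h₁ : D₁ ∈ Divisor.degreeZero K H.FunctionField)
      (h₂ : D₂ ∈ Divisor.degreeZero K H.FunctionField)
      (k₁ : E₁ ∈ Divisor.degreeZero K H.FunctionField)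
      (k₂ : E₂ ∈ Divisor.degreeZero K H.FunctionField),
      D₁.cls h₁ + D₂.cls h₂ = E₁.cls k₁ + E₂.cls k₂ ∧
      -- its computation
      (t ≠ 0 → s ≠ μx → s ≠ ωx → μx ≠ ωx →
        ∀ (m : K) (u₁ u₂ : K[X]), m = H.tangentSlope s t →
          u₁ = X ^ 2 - C (2 * s) * X + C (s ^ 2) →
          u₂ = X ^ 2 - C (μx + ωx) * X + C (μx * ωx) →
          H.IsMumford u₁ (C m * X + C (t - m * s)) E₁ ∧
          H.IsMumford u₂ (C ((μy - ωy) / (μx - ωx)) * X +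
            C ((μx * ωy - ωx * μy) / (μx - ωx))) E₂ ∧
          (∃! c : Fin 4 → K,
            (sharedMatrix s μx ωx).mulVec c = sharedVector m s t μx μy ωx ωy) ∧
          ∀ P Q R S : K,
            (sharedMatrix s μx ωx).mulVec ![P, Q, R, S] = sharedVector m s t μx μy ωx ωy →
            ∀ L q u v : K[X], L = C P * X ^ 3 + C Q * X ^ 2 + C R * X + C S →
              q = (L ^ 2 - H.f) / (u₁ * u₂) → u = C q.leadingCoeff⁻¹ * q → v = L % u →
              L ^ 2 - H.f = u₁ * u₂ * q ∧
              (P ≠ 0 → q.natDegree = 2 ∧ q.leadingCoeff = P ^ 2) ∧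
              (P = 0 → q.natDegree = 1 ∧ q.leadingCoeff = -H.f.leadingCoeff) ∧
              ∃ (G : Divisor K H.FunctionField) (hG : G ∈ Divisor.degreeZero K H.FunctionField)
                (hG' : H.involutionDivisor G ∈ Divisor.degreeZero K H.FunctionField),
                H.IsMumford u v G ∧ H.IsMumford u (-v) (H.involutionDivisor G) ∧
                D₁.cls h₁ + D₂.cls h₂ = -G.cls hG ∧
                D₁.cls h₁ + D₂.cls h₂ = (H.involutionDivisor G).cls hG') := by
  subst hD₁ hD₂ hE₁ hE₂
  have d𝔭 := h𝔭.mem_degreeZero hinf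
  have d𝔪 := h𝔪.mem_degreeZero hinf
  have d𝔴 := h𝔴.mem_degreeZero hinf
  refine ⟨fun a b α β v₁ v₂ hM₁ hM₂ => ?_, ?_, ?_, ?_, ?_, ?_, ?_⟩
  · obtain ⟨rfl, rfl, h1, h2⟩ := hM₁.roots h𝔭 h𝔪 hinf
    obtain ⟨rfl, rfl, h3, h4⟩ := hM₂.roots h𝔭 h𝔴 hinf
    refine ⟨det_interpolationMatrix s μx ωx, fun hne => ?_⟩
    have hne' : -(s + μx) - -(s + ωx) ≠ 0 := by
      intro h
      exact hne (by linear_combination -h)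
    refine ⟨sub_ne_zero.1 hne', ?_, h1.symm, by ring, h2.symm, by ring, h4.symm⟩
    rw [eq_div_iff hne']
    ring
  · convert add_mem d𝔭 d𝔪 using 1
    abel
  · convert add_mem d𝔭 d𝔴 using 1
    abel
  · convert add_mem d𝔭 d𝔭 using 1
    abel
  · convert add_mem d𝔪 d𝔴 using 1
    abel
  -- The two sums agree already as divisors.
  · rw [Divisor.cls_add, Divisor.cls_add]
    congr 1
    abel
  intro ht hsμ hsω hμω m u₁ u₂ hm hu₁ hu₂
  have hu₁' : u₁ = (X - C s) * (X - C s) := by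
    rw [hu₁]
    simp only [map_mul, map_pow, map_ofNat]
    ring
  have hu₂' : u₂ = (X - C μx) * (X - C ωx) := by
    rw [hu₂]
    simp only [map_add, map_mul]
    ring
  clear hu₁ hu₂
  have hμω' := sub_ne_zero.2 hμω
  set V₁ : K[X] := C m * X + C (t - m * s) with hV₁
  set V₂ : K[X] := C ((μy - ωy) / (μx - ωx)) * X + C ((μx * ωy - ωx * μy) / (μx - ωx)) with hV₂
  have hV₁s : V₁.eval s = t := by simp [hV₁]
  have hV₂μ : V₂.eval μx = μy := by
    simp only [hV₂, eval_add, eval_mul, eval_C, eval_X]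
    field_simp
    ring
  have hV₂ω : V₂.eval ωx = ωy := by
    simp only [hV₂, eval_add, eval_mul, eval_C, eval_X]
    field_simp
    ring
  have hm₁ : u₁.Monic := hu₁' ▸ (monic_X_sub_C s).mul (monic_X_sub_C s)
  have hm₂ : u₂.Monic := hu₂' ▸ (monic_X_sub_C μx).mul (monic_X_sub_C ωx)
  have hn₁ : u₁.natDegree = 2 := by
    rw [hu₁', natDegree_mul (X_sub_C_ne_zero s) (X_sub_C_ne_zero s), natDegree_X_sub_C]
  have hn₂ : u₂.natDegree = 2 := by
    rw [hu₂', natDegree_mul (X_sub_C_ne_zero μx) (X_sub_C_ne_zero ωx), natDegree_X_sub_C,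
      natDegree_X_sub_C]
  have hdvd₁ : u₁ ∣ H.f - V₁ ^ 2 := by
    rw [hu₁']
    -- Tangency: `f - V₁²` and its derivative `f' - 2 V₁ m` both vanish at `s`, by the choice of
    -- `m`.
    refine sq_X_sub_C_dvd ?_ ?_
    · rw [eval_sub, eval_pow, hV₁s, h𝔭.eval_f, sub_self]
    · have h2t : 2 * t ≠ 0 := mul_ne_zero H.two_ne_zero ht
      have hder : V₁.derivative = C m := by simp [hV₁]
      rw [derivative_sub, derivative_sq, hder, eval_sub, eval_mul, eval_mul, hV₁s, eval_C, eval_C,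
        hm, tangentSlope, mul_div_cancel₀ _ h2t, sub_self]
  have hcop (c d : K) (h : c ≠ d) : IsCoprime (X - C c) (X - C d) :=
    isCoprime_X_sub_C_of_isUnit_sub (sub_ne_zero.2 h).isUnit
  have hdvd₂ : u₂ ∣ H.f - V₂ ^ 2 := by
    rw [hu₂']
    exact (hcop _ _ hμω).mul_dvd (h𝔪.X_sub_C_dvd hV₂μ) (h𝔴.X_sub_C_dvd hV₂ω)
  have hcop₁₂ : IsCoprime u₁ u₂ := by
    rw [hu₁', hu₂']
    exact ((hcop _ _ hsμ).mul_left (hcop _ _ hsμ)).mul_right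
      ((hcop _ _ hsω).mul_left (hcop _ _ hsω))
  have hP₁ : IsPairDivisor u₁ V₁ (2 • Finsupp.single 𝔭 1 - 2 • Finsupp.single inf 1) := by
    have hp := h𝔭.isPairDivisor hV₁s hinf
    rw [hu₁'] at hdvd₁ ⊢
    convert hp.add hp hdvd₁ using 1
    abel
  have hP₂ : IsPairDivisor u₂ V₂
      (Finsupp.single 𝔪 1 + Finsupp.single 𝔴 1 - 2 • Finsupp.single inf 1) := by
    rw [hu₂'] at hdvd₂ ⊢
    convert (h𝔪.isPairDivisor hV₂μ hinf).add (h𝔴.isPairDivisor hV₂ω hinf) hdvd₂ using 1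
    abel
  have hlt {u : K[X]} (hu : u.natDegree = 2) (c d : K) : (C c * X + C d).degree < u.degree := by
    rw [degree_eq_natDegree (ne_zero_of_natDegree_gt (hu ▸ two_pos : 0 < u.natDegree)), hu]
    exact degree_linear_le.trans_lt (by norm_num)
  have hdet : (sharedMatrix s μx ωx).det ≠ 0 := by
    rw [det_sharedMatrix]
    exact mul_ne_zero (pow_ne_zero _ (sub_ne_zero.2 hsμ)) (pow_ne_zero _ (sub_ne_zero.2 hsω))
  refine ⟨hP₁.isMumford hm₁ hn₁.le (hlt hn₁ _ _) hdvd₁,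
    hP₂.isMumford hm₂ hn₂.le (hlt hn₂ _ _) hdvd₂, existsUnique_mulVec_eq hdet _, ?_⟩
  intro P Q R S hsys L q u v hL hq hu hv
  obtain ⟨hL₁, hL₂⟩ := dvd_sub_of_mulVec_eq hsys
  rw [← hL, ← hu₁', ← hV₁] at hL₁
  rw [← hL, ← hu₂', ← hV₂] at hL₂
  have hdvdL {w V : K[X]} (h : w ∣ H.f - V ^ 2) (h' : w ∣ L - V) : w ∣ L ^ 2 - H.f := by
    have h1 : L ^ 2 - H.f = (L - V) * (L + V) - (H.f - V ^ 2) := by ring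
    rw [h1]
    exact dvd_sub (h'.mul_right _) h
  -- Divisibility by `u₁` and by `u₂` combines because they are coprime; distinctness of `s` from
  -- the other two abscissas enters here.
  obtain ⟨k, hk⟩ := hcop₁₂.mul_dvd (hdvdL hdvd₁ hL₁) (hdvdL hdvd₂ hL₂)
  have hm₁₂ : (u₁ * u₂).Monic := hm₁.mul hm₂
  obtain rfl : q = k := by rw [hq, hk, mul_div_cancel_left₀ _ hm₁₂.ne_zero]
  have hq0 : q ≠ 0 := by
    rintro rfl
    rw [mul_zero] at hk
    exact f_sub_sq_ne_zero (H := H) L (by rw [← neg_sub, hk, neg_zero])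
  have hnat : (L ^ 2 - H.f).natDegree = 4 + q.natDegree := by
    rw [hk, hm₁₂.natDegree_mul' hq0, hm₁.natDegree_mul hm₂, hn₁, hn₂]
  have hlead : (L ^ 2 - H.f).leadingCoeff = q.leadingCoeff := by
    rw [hk, leadingCoeff_monic_mul hm₁₂]
  have hc₁ : P ≠ 0 → q.natDegree = 2 ∧ q.leadingCoeff = P ^ 2 := by
    intro hP
    obtain ⟨h1, h2⟩ := natDegree_sq_sub H.natDegree_f hP Q R S
    rw [← hL] at h1 h2
    exact ⟨by omega, hlead ▸ h2⟩
  have hc₂ : P = 0 → q.natDegree = 1 ∧ q.leadingCoeff = -H.f.leadingCoeff := by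
    rintro rfl
    obtain ⟨h1, h2⟩ := natDegree_sq_sub' H.natDegree_f Q R S
    rw [← hL] at h1 h2
    exact ⟨by omega, hlead ▸ h2⟩
  refine ⟨hk, hc₁, hc₂, ?_⟩
  have hlq : q.leadingCoeff ≠ 0 := leadingCoeff_ne_zero.2 hq0
  have hum : u.Monic := by
    rw [hu, mul_comm]
    exact monic_mul_leadingCoeff_inv hq0
  have hun : u.natDegree ≤ 2 := by
    rw [hu, natDegree_C_mul (inv_ne_zero hlq)]
    by_cases hP : P = 0
    · have := (hc₂ hP).1
      omega
    · have := (hc₁ hP).1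
      omega
  have hqu : q = C q.leadingCoeff * u := by
    rw [hu, ← mul_assoc, ← C_mul, mul_inv_cancel₀ hlq, C_1, one_mul]
  have hfL : H.f - L ^ 2 = u₁ * u₂ * (C (-q.leadingCoeff) * u) := by
    rw [map_neg, neg_mul, ← hqu, mul_neg, ← hk, neg_sub]
  have huL : u ∣ H.f - L ^ 2 := hfL ▸ (dvd_mul_left u _).mul_left _
  have huv : u ∣ L - v := by
    rw [hv]
    exact ⟨L / u, by linear_combination -EuclideanDomain.div_add_mod L u⟩
  have hufv : u ∣ H.f - v ^ 2 := by
    have h1 : H.f - v ^ 2 = (H.f - L ^ 2) + (L - v) * (L + v) := by ring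
    rw [h1]
    exact dvd_add huL (huv.mul_right _)
  have hufv' : u ∣ H.f - (-v) ^ 2 := by rwa [neg_sq]
  have hdeg : v.degree < u.degree := hv ▸ EuclideanDomain.mod_lt L hum.ne_zero
  obtain ⟨G, hG, hGp⟩ := exists_isPairDivisor hinf hufv
  have hGi := hGp.involution hum.ne_zero
  have hG' := hGi.mem_degreeZero hinf hufv'
  -- All divisors are rewritten with the same second entry `L`, so that additivity applies.
  have hGL : IsPairDivisor u L G :=
    hGp.congr hum.ne_zero (by rw [← neg_sub]; exact (dvd_neg (α := K[X])).2 huv)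
  have hunit : IsUnit (C (-q.leadingCoeff)) := isUnit_C.2 (neg_ne_zero.2 hlq).isUnit
  have h12 := (hP₁.congr hm₁.ne_zero (w := L) (by
    rw [← neg_sub]; exact (dvd_neg (α := K[X])).2 hL₁)).add
    (hP₂.congr hm₂.ne_zero (w := L) (by rw [← neg_sub]; exact (dvd_neg (α := K[X])).2 hL₂))
    (hfL ▸ dvd_mul_right _ _)
  -- The constant factor of `f - L²` contributes the zero divisor.
  have h34 := (IsPairDivisor.of_isUnit (H := H) (v := L) hunit).add hGL
    (hfL ▸ dvd_mul_left _ _)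
  have hprin := (hfL ▸ h12.add h34 (by rw [hfL]) :
    IsPairDivisor (H.f - L ^ 2) L _).mem_principal
  have hneg : ∀ h, ∀ h', Divisor.cls (Finsupp.single 𝔭 1 + Finsupp.single 𝔪 1 -
      2 • Finsupp.single inf 1 : Divisor K H.FunctionField) h + Divisor.cls (Finsupp.single 𝔭 1 +
      Finsupp.single 𝔴 1 - 2 • Finsupp.single inf 1) h' = -G.cls hG := by
    intro h h'
    rw [Divisor.cls_add]
    refine Divisor.cls_eq_neg_of_add_mem_principal _ _ ?_
    convert hprin using 1
    abel
  refine ⟨G, hG, hG', hGp.isMumford hum hun hdeg hufv,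
    hGi.isMumford hum hun (by rwa [degree_neg]) hufv', hneg _ _, ?_⟩
  -- The sum of `G` and its image under the involution is the divisor of the polynomial `u`.
  rw [hneg, eq_comm]
  refine Divisor.cls_eq_neg_of_add_mem_principal _ _ ?_
  rw [add_comm]
  exact hGp.add_neg_mem_principal hGi hufv
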